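/- **Setting.** Let $\kappa$ be the security parameter. Paillier keys are generated as follows: primes $p\neq q$ with $\gcd(pq,(p-1)(q-1))=1$ are drawn from an arbitrary law (depending on $\kappa$) whose primes have at least $\kappa$ and at most polynomially many bits; $n=pq$; $g$ is uniform among the elements of $(\mathbb Z/n^2)^\ast$ for which $L(g^{\lambda}\bmod n^2)$ is invertible modulo $n$, where $\lambda=\mathrm{lcm}(p-1,q-1)$ and $L(x)=(x-1)/n$. The public key is $(n,g)$. A plaintext $c\in\mathbb Z/n$ is encrypted as $\llbracket c\rrbracket=g^{c}r^{n}\bmod n^2$ with $r$ uniform in $(\mathbb Z/n)^\ast$; vectors are encrypted coordinatewise with independent randomness. Assume the Decisional Composite Residuosity (DCR) assumption for this law of $n$: every probabilistic polynomial-time (PPT) distinguisher, given $1^\kappa$, $n$ and either a uniformly random $n$-th power in $(\mathbb Z/n^2)^\ast$ or a uniformly random element of $(\mathbb Z/n^2)^\ast$, has negligible distinguishing advantage. Let the number $N$ of devices, the dimension $d$ and the index $t$ of the current round be functions of $\kappa$ that can be computed from $1^\kappa$ in polynomial time, with output in unary (for instance constants). Device $i$ has gradients $v_1^{(i)},\dots,v_t^{(i)}\in(\mathbb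 Z/n)^d$, historical contribution $cv_i=\sum_{s=1}^{t}v_s^{(i)}$ and a public status $f_i\in\{1,-1\}$ ($1$: normal, $-1$: unlearning). In round $t$ of VerFU it uploads $x_i=\llbracket v_t^{(i)}\rrbracket$ if $f_i=1$ and $x_i=\llbracket cv_i\rrbracket$ if $f_i=-1$, and the encrypted aggregation/unlearning result is $\llbracket a\rrbracket=\prod_i x_i^{f_i}\bmod n^2$ (coordinatewise). The adversary's view is $1^\kappa$, the public key, and all $f_i$, all $x_i$ and $\llbracket a\rrbracket$. **Theorem 2 (Privacy of input gradients).** Under the DCR assumption: 1. (Indistinguishability.) Let a PPT adversary, knowing $1^\kappa$ and the public key, choose the statuses and two candidate families of gradient histories. If one of the two families, picked by a fair coin, is used in the round, then the adversary, given the resulting view, guesses which one with probability $\frac12$ up to a negligible error. 2. (No recovery.) For every PPT adversary $M$ there is a PPT algorithm $M'$ such that for every PPT sampler $S$, which from $1^\kappa$ and the public key produces the statuses, the gradient histories of all devices and some side information $z$, there is a negligible function $\varepsilon$ with $$\Pr[M(\text{view},z)\text{ outputs a true claim}]\le\Pr[M'(1^\kappa,n,g,(f_i)_i,z)\text{ outputs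 a true claim}]+\varepsilon(\kappa)\quad\text{for all }\kappa.$$ A claim names a device $i$ together with either a round $s\in\{1,\dots,t\}$ and an alleged value of $v_s^{(i)}$, or an alleged value of $cv_i$. So the uploads and the encrypted result help $M$ to recover a true gradient or historical contribution of any device only with negligible advantage over an algorithm that sees no ciphertext. -/

import Mathlib

open Asymptotics Filter

noncomputable section

namespace VerFU

/-! ### Machine model with a step count

Structured programs over binary trees with natural numbers at the leaves. The arithmetic instructions
act on binary numbers; each elementary instruction costs the total bit size of what it reads and of
what it writes (logarithmic cost), so that the cost of a run and the number of steps of a Turing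
machine that performs it are polynomially related. -/

/-- The values that programs compute on. -/
inductive Data where
  | num : ℕ → Data
  | pair : Data → Data → Data

/-- Bit size of a value. -/
def Data.size : Data → ℕ
  | .num n => Nat.size n + 1
  | .pair a b => a.size + b.size + 1

/-- Elementary instructions. -/
inductive Instr where
  | id | const (k : ℕ) | fst | snd | add | sub | mul | div | mod

/-- Effect of an elementary instruction (`0` on an operand of the wrong shape). -/
def Instr.eval : Instr → Data → Data
  | .id, x => x
  | .const k, _ => .num k
  | .fst, .pair a _ => a
  | .snd, .pair _ b => b
  | .add, .pair (.num a) (.num b) => .num (a + b)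
  | .sub, .pair (.num a) (.num b) => .num (a - b)
  | .mul, .pair (.num a) (.num b) => .num (a * b)
  | .div, .pair (.num a) (.num b) => .num (a / b)
  | .mod, .pair (.num a) (.num b) => .num (a % b)
  | _, _ => .num 0

/-- Programs: elementary instructions, sequencing, pairing, branching and unbounded `while` loops. -/
inductive Prog where
  | instr (i : Instr)
  | seq (f g : Prog)
  | pair (f g : Prog)
  | ite (c f g : Prog)
  | while (c f : Prog)

/-- `Runs p x y t`: started on `x`, the program `p` halts with output `y` at cost `t`.
A test succeeds when its value is different from the number `0`. -/
inductive Runs : Prog → Data → Data → ℕ → Prop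
  | instr (i : Instr) (x : Data) : Runs (.instr i) x (i.eval x) (x.size + (i.eval x).size)
  | seq {f g x y z t₁ t₂} : Runs f x y t₁ → Runs g y z t₂ → Runs (.seq f g) x z (t₁ + t₂)
  | pair {f g x y z t₁ t₂} :
      Runs f x y t₁ → Runs g x z t₂ → Runs (.pair f g) x (.pair y z) (t₁ + t₂ + 1)
  | iteTrue {c f g x v y t₁ t₂} :
      Runs c x v t₁ → v ≠ .num 0 → Runs f x y t₂ → Runs (.ite c f g) x y (t₁ + t₂)
  | iteFalse {c f g x y t₁ t₂} :
      Runs c x (.num 0) t₁ → Runs g x y t₂ → Runs (.ite c f g) x y (t₁ + t₂)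
  | whileTrue {c f x v y z t₁ t₂ t₃} :
      Runs c x v t₁ → v ≠ .num 0 → Runs f x y t₂ → Runs (.while c f) y z t₃ →
      Runs (.while c f) x z (t₁ + t₂ + t₃)
  | whileFalse {c f x t} : Runs c x (.num 0) t → Runs (.while c f) x x (t + x.size)

/-- Encoding of the elements of a type as values of the machine. -/
class ToData (α : Type) where
  toData : α → Data

open ToData (toData)

/-- A natural number written in unary: `⟨κ⟩` stands for the string `1^κ`. -/
structure Unary where
  len : ℕ

/-- Lists of values, as nested pairs closed by `0`. -/
def listData : List Data → Data
  | [] => .num 0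
  | a :: l => .pair a (listData l)

instance : ToData Data := ⟨fun x => x⟩
instance : ToData ℕ := ⟨Data.num⟩
instance : ToData Bool := ⟨fun b => .num (if b then 1 else 0)⟩
instance {α β : Type} [ToData α] [ToData β] : ToData (α × β) :=
  ⟨fun x => .pair (toData x.1) (toData x.2)⟩
instance {α : Type} [ToData α] : ToData (List α) := ⟨fun l => listData (l.map toData)⟩
instance {α : Type} [ToData α] : ToData (Option α) :=
  ⟨fun o => o.elim (.num 0) (fun a => .pair (.num 0) (toData a))⟩
instance : ToData Unary := ⟨fun u => toData (List.replicate u.len (1 : ℕ))⟩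

/-- `f` is computed by a program whose cost is at most a polynomial in the bit size of the input. -/
def PolyTime {α β : Type} [ToData α] [ToData β] (f : α → β) : Prop :=
  ∃ (p : Prog) (P : Polynomial ℕ), ∀ a : α,
    ∃ t : ℕ, t ≤ P.eval (toData a).size ∧ Runs p (toData a) (toData (f a)) t

/-- A size parameter of the system (as a function of the security parameter) that can be computed
in polynomial time, in unary; in particular it is polynomially bounded. -/
def EfficientParam (N : ℕ → ℕ) : Prop :=
  PolyTime (fun u : Unary => (⟨N u.len⟩ : Unary))

/-- Probabilistic polynomial-time algorithms: polynomial-time functions of the input and of a tape of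
polynomially many fair coins (the tape is the binary number in the first component). -/
structure PPT (α β : Type) [ToData α] [ToData β] where
  coins : Polynomial ℕ
  fn : ℕ × α → β
  polyTime : PolyTime fn

/-- Output distribution of a PPT algorithm for the security parameter `κ`. -/
def PPT.run {α β : Type} [ToData α] [ToData β] (A : PPT α β) (κ : ℕ) (a : α) : PMF β :=
  (PMF.uniformOfFintype (Fin (2 ^ A.coins.eval κ))).map fun ρ => A.fn (ρ.val, a)

/-- Negligible functions of the security parameter. -/
def Negligible (ε : ℕ → ℝ) : Prop := SuperpolynomialDecay atTop (fun κ : ℕ => (κ : ℝ)) ε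

/-- Probability that an experiment outputs `true`. -/
def prob (e : PMF Bool) : ℝ := (e true).toReal

/-! ### The Paillier cryptosystem -/

/-- Admissible pairs of primes. -/
structure PrimePair where
  p : ℕ
  q : ℕ
  prime_p : p.Prime
  prime_q : q.Prime
  ne : p ≠ q
  coprime : Nat.Coprime (p * q) ((p - 1) * (q - 1))

namespace PrimePair

variable (P : PrimePair)

/-- The modulus. -/
def n : ℕ := P.p * P.q

/-- `λ = lcm(p-1, q-1)`. -/
def lam : ℕ := Nat.lcm (P.p - 1) (P.q - 1)

theorem one_lt_n : 1 < P.n := by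
  have h1 := P.prime_p.one_lt
  have h2 := P.prime_q.one_lt
  unfold n
  nlinarith

instance : NeZero P.n := ⟨by have := P.one_lt_n; omega⟩

/-- Plaintexts are residues modulo `n`. -/
abbrev Plain : Type := ZMod P.n

/-- Ciphertexts are the elements of `(ℤ/n²)ˣ`. -/
abbrev Cipher : Type := (ZMod (P.n ^ 2))ˣ

/-- The natural number that represents a ciphertext. -/
def repr (c : P.Cipher) : ℕ := (c : ZMod (P.n ^ 2)).val

/-- `L(x) = (x - 1) / n`. -/
def L (x : ℕ) : ℕ := (x - 1) / P.n

/-- The generators `g` for which the private key `μ = L(g^λ mod n²)⁻¹ mod n` exists. -/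
def IsBase (g : P.Cipher) : Prop := IsUnit ((P.L (P.repr (g ^ P.lam)) : ℕ) : ZMod P.n)

theorem lam_coprime : Nat.Coprime P.lam P.n := by
  have h : P.lam ∣ (P.p - 1) * (P.q - 1) := Nat.lcm_dvd_mul _ _
  exact (Nat.Coprime.coprime_dvd_right h P.coprime).symm

instance : Nonempty {g : P.Cipher // P.IsBase g} := by
  have hn := P.one_lt_n
  have hc : Nat.Coprime (1 + P.n) (P.n ^ 2) := by
    apply Nat.Coprime.pow_right
    simp
  refine ⟨⟨ZMod.unitOfCoprime (1 + P.n) hc, ?_⟩⟩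
  have key : ∀ m : ℕ, ((1 + P.n : ℕ) : ZMod (P.n ^ 2)) ^ m
      = ((1 + (m % P.n) * P.n : ℕ) : ZMod (P.n ^ 2)) := by
    have hsq : ((P.n : ℕ) : ZMod (P.n ^ 2)) * (P.n : ZMod (P.n ^ 2)) = 0 := by
      have := ZMod.natCast_self (P.n ^ 2)
      rw [← this]; push_cast; ring
    have h1 : ∀ m : ℕ, ((1 + P.n : ℕ) : ZMod (P.n ^ 2)) ^ m
        = ((1 + m * P.n : ℕ) : ZMod (P.n ^ 2)) := by
      intro m
      induction m with
      | zero => simp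
      | succ k ih =>
        rw [pow_succ _ k, ih]; push_cast
        linear_combination (k : ZMod (P.n ^ 2)) * hsq
    intro m
    rw [h1 m]
    conv_lhs => rw [← Nat.mod_add_div m P.n]
    push_cast
    linear_combination ((m / P.n : ℕ) : ZMod (P.n ^ 2)) * hsq
  have hval : P.repr (ZMod.unitOfCoprime (1 + P.n) hc ^ P.lam) = 1 + (P.lam % P.n) * P.n := by
    unfold repr
    rw [Units.val_pow_eq_pow_val, ZMod.coe_unitOfCoprime, key, ZMod.val_natCast]
    apply Nat.mod_eq_of_lt
    have : P.lam % P.n < P.n := Nat.mod_lt _ (by omega)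
    nlinarith
  unfold IsBase L
  rw [hval, Nat.add_sub_cancel_left, Nat.mul_div_cancel _ (by omega), ZMod.natCast_mod]
  exact (ZMod.isUnit_iff_coprime _ _).2 P.lam_coprime

open Classical in
/-- A uniformly random admissible `g`. -/
def baseLaw : PMF {g : P.Cipher // P.IsBase g} := PMF.uniformOfFintype _

/-- A unit modulo `n`, lifted to `{0, …, n-1}` and read modulo `n²`. -/
def lift (r : (ZMod P.n)ˣ) : P.Cipher :=
  ZMod.unitOfCoprime (r : ZMod P.n).val ((ZMod.val_coe_unit_coprime r).pow_right 2)

/-- `HE.Enc`: `g^c r^n mod n²`. -/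
def enc (g : P.Cipher) (c : P.Plain) (r : (ZMod P.n)ˣ) : P.Cipher :=
  g ^ c.val * P.lift r ^ P.n

end PrimePair

/-- The selection of the two large primes in `HE.Gen`: an arbitrary law whose primes have at least
`κ` and at most polynomially many bits. -/
structure PrimeGen where
  law : ℕ → PMF PrimePair
  maxBits : Polynomial ℕ
  large : ∀ κ, ∀ P ∈ (law κ).support, κ ≤ Nat.size P.p ∧ κ ≤ Nat.size P.q
  bounded : ∀ κ, ∀ P ∈ (law κ).support,
    Nat.size P.p ≤ maxBits.eval κ ∧ Nat.size P.q ≤ maxBits.eval κ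

/-- The experiment of a distinguisher for composite residuosity: it is given `1^κ`, `n` and an
element of `(ℤ/n²)ˣ`, a uniformly random `n`-th power (`real = true`) or uniformly random. -/
def dcrGame (gen : PrimeGen) (D : PPT (Unary × ℕ × ℕ) Bool) (real : Bool) (κ : ℕ) : PMF Bool := do
  let P ← gen.law κ
  let z ← PMF.uniformOfFintype P.Cipher
  D.run κ (⟨κ⟩, P.n, P.repr (if real then z ^ P.n else z))

/-- The Decisional Composite Residuosity assumption. -/
def DCR (gen : PrimeGen) : Prop :=
  ∀ D : PPT (Unary × ℕ × ℕ) Bool,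
    Negligible fun κ => |prob (dcrGame gen D true κ) - prob (dcrGame gen D false κ)|

/-! ### One round of VerFU: uploads and aggregation with unlearning -/

/-- Gradient histories as lists: for each device, the list of its gradients in the rounds
`1, 2, …`, each the list of its coordinates. Missing entries are read as `0`. -/
abbrev Histories : Type := List (List (List ℕ))

/-- Gradient `v_s^{(i)}` of device `i` in round `s ≥ 1`, as a vector of plaintexts. -/
def gradient (P : PrimePair) (d : ℕ) (h : Histories) (i s : ℕ) : Fin d → P.Plain :=
  fun k => ((((h.getD i []).getD (s - 1) []).getD k 0 : ℕ) : P.Plain)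

/-- Historical contribution `cv_i` accumulated up to round `t`. -/
def contribution (P : PrimePair) (d : ℕ) (h : Histories) (i t : ℕ) : Fin d → P.Plain :=
  ∑ s ∈ Finset.Icc 1 t, gradient P d h i s

/-- Status of device `i`: `true` for a normal device (`f_i = 1`), `false` for an unlearning device
(`f_i = -1`). -/
def status (f : List Bool) (i : ℕ) : Bool := f.getD i true

/-- Plaintext update of device `i` in round `t`. -/
def update (P : PrimePair) (d t : ℕ) (f : List Bool) (h : Histories) (i : ℕ) : Fin d → P.Plain :=
  if status f i then gradient P d h i t else contribution P d h i t

/-- Uploaded ciphertexts `x_i`: the coordinatewise encryptions of the updates. -/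
def uploads (P : PrimePair) (g : P.Cipher) (N d t : ℕ) (f : List Bool) (h : Histories)
    (r : Fin N → Fin d → (ZMod P.n)ˣ) : Fin N → Fin d → P.Cipher :=
  fun i k => P.enc g (update P d t f h i k) (r i k)

/-- The encrypted unlearning result `⟦a⟧`: `⊕` over normal and `⊖` over unlearning devices. -/
def aggregate (P : PrimePair) {N d : ℕ} (f : List Bool) (x : Fin N → Fin d → P.Cipher) :
    Fin d → P.Cipher :=
  fun k => ∏ i : Fin N, if status f i then x i k else (x i k)⁻¹

/-- What everybody knows: `1^κ` and the public key `(n, g)`. -/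
abbrev Pub : Type := Unary × ℕ × ℕ

/-- The statuses `(f_i)`, the uploads `(x_i)` and the encrypted result `⟦a⟧`. -/
abbrev View : Type := List Bool × List (List ℕ) × List ℕ

/-- The statuses of the `N` devices as a list. -/
def statusList (N : ℕ) (f : List Bool) : List Bool := List.ofFn fun i : Fin N => status f i

/-- The adversary's view of the round. -/
def view (P : PrimePair) (g : P.Cipher) (N d t : ℕ) (f : List Bool) (h : Histories)
    (r : Fin N → Fin d → (ZMod P.n)ˣ) : View :=
  let x := uploads P g N d t f h r
  (statusList N f, List.ofFn fun i => List.ofFn fun k => P.repr (x i k),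
    List.ofFn fun k => P.repr (aggregate P f x k))

/-- A random view: all encryptions use independent uniform randomness. -/
def viewLaw (P : PrimePair) (g : P.Cipher) (N d t : ℕ) (f : List Bool) (h : Histories) : PMF View :=
  (PMF.uniformOfFintype (Fin N → Fin d → (ZMod P.n)ˣ)).map (view P g N d t f h)

/-- Indistinguishability experiment. Knowing the public key, `A` chooses the statuses and two
candidate gradient histories (and keeps a state); one of the two is used in the round, and `B` has to
tell from the view which one. The output says whether `B` is right. -/
def indGame (gen : PrimeGen) (N d t : ℕ → ℕ)
    (A : PPT Pub (List Bool × Histories × Histories × Data)) (B : PPT (Pub × View × Data) Bool)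
    (κ : ℕ) : PMF Bool := do
  let P ← gen.law κ
  let g ← P.baseLaw
  let pub : Pub := (⟨κ⟩, P.n, P.repr g.1)
  let c ← A.run κ pub
  let b ← PMF.uniformOfFintype Bool
  let v ← viewLaw P g.1 (N κ) (d κ) (t κ) c.1 (if b then c.2.1 else c.2.2.1)
  let b' ← B.run κ (pub, v, c.2.2.2)
  return b' == b

/-- A claim about the secrets of a device: device `i`, and either a round `s` together with the
alleged gradient of that round, or `none` together with the alleged historical contribution. -/
abbrev Claim : Type := ℕ × Option ℕ × List ℕ

open Classical in
/-- Whether a claim is true. -/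
def Claim.correct (P : PrimePair) (N d t : ℕ) (h : Histories) (c : Claim) : Bool :=
  let u : Fin d → P.Plain := fun k => ((c.2.2.getD k 0 : ℕ) : P.Plain)
  match c.2.1 with
  | some s => decide (c.1 < N ∧ 1 ≤ s ∧ s ≤ t ∧ u = gradient P d h c.1 s)
  | none => decide (c.1 < N ∧ u = contribution P d h c.1 t)

/-- Recovery experiment. `S` samples the statuses, the gradient histories of the devices and some side
information on them; `M` sees the view and the side information and has to make a true claim. -/
def recoverGame (gen : PrimeGen) (N d t : ℕ → ℕ) (S : PPT Pub (List Bool × Histories × Data))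
    (M : PPT (Pub × View × Data) Claim) (κ : ℕ) : PMF Bool := do
  let P ← gen.law κ
  let g ← P.baseLaw
  let pub : Pub := (⟨κ⟩, P.n, P.repr g.1)
  let c ← S.run κ pub
  let v ← viewLaw P g.1 (N κ) (d κ) (t κ) c.1 c.2.1
  let w ← M.run κ (pub, v, c.2.2)
  return Claim.correct P (N κ) (d κ) (t κ) c.2.1 w

/-- The same experiment for an algorithm that sees no ciphertext at all: it is given the public key,
the statuses and the side information. -/
def blindGame (gen : PrimeGen) (N d t : ℕ → ℕ) (S : PPT Pub (List Bool × Histories × Data))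
    (M' : PPT (Pub × List Bool × Data) Claim) (κ : ℕ) : PMF Bool := do
  let P ← gen.law κ
  let g ← P.baseLaw
  let pub : Pub := (⟨κ⟩, P.n, P.repr g.1)
  let c ← S.run κ pub
  let w ← M'.run κ (pub, statusList (N κ) c.1, c.2.2)
  return Claim.correct P (N κ) (d κ) (t κ) c.2.1 w

end VerFU

end

noncomputable section

namespace VerFU

open ToData (toData)

/-! ### Polynomial bounds -/

/-! The argument makes the key lossy instead of replacing the ciphertexts one by one. The map `g ↦
L(g^λ)` is a surjective homomorphism onto `ℤ/n`, so admissible generators have density `φ(n)/n` in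
`(ℤ/n²)ˣ`. For primes of at least `κ` bits this is exponentially close to `1`, hence an honest `g`
is statistically a uniform element (`statClose_baseLaw`). By DCR such an element may be exchanged
for a random `n`-th power `z^n` (`negligible_honest_sub_lossy`).

Under the generator `z^n` an encryption is `(z^c r)^n`, which depends only on `z^c r` modulo `n`.
Since `r` is a uniform unit, the factor `z^c` is absorbed by a translation of the randomness, and
the law of all uploads no longer depends on the plaintexts. The encrypted result is a function of
the uploads, so the same holds for the whole view (`viewLaw_pow_n`). One use of DCR thus treats all
`N * d` ciphertexts, without a hybrid argument.

With a lossy key the guess in the first part is right with probability exactly `1/2`. For the second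
part, `M'` runs `M` on encryptions of `0`: the experiments with true and with zero plaintexts are
both close to the same lossy experiment (`exists_simulator`).

DCR only speaks about polynomial-time distinguishers, so each experiment, including the test whether
a claim is true, has to be executed by a program. Most of the work goes into closure properties of
`PolyTime`, chiefly `PolyTime.foldl`, into modular powers and inverses, and into sampling encryption
randomness from fair coins up to a negligible error (`statClose_simView`). -/

theorem Data.one_le_size (x : Data) : 1 ≤ x.size := by
  cases x <;> simp [Data.size]

/-- Writing is charged for, so a time bound is also a bound on the output. This is what makes
composition preserve polynomial time. -/
theorem Runs.size_le {p : Prog} {x y : Data} {t : ℕ} (h : Runs p x y t) : y.size ≤ t := by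
  induction h <;> (try simp only [Data.size] at *) <;> omega

theorem eval_natPoly_mono (P : Polynomial ℕ) {a b : ℕ} (h : a ≤ b) : P.eval a ≤ P.eval b := by
  rw [Polynomial.eval_eq_sum, Polynomial.eval_eq_sum]
  exact Finset.sum_le_sum fun i _ => Nat.mul_le_mul_left _ (Nat.pow_le_pow_left h i)

/-- `f` is bounded by a polynomial in the bit size of its argument. -/
def PolyBounded {α : Type} [ToData α] (f : α → ℕ) : Prop :=
  ∃ Q : Polynomial ℕ, ∀ a, f a ≤ Q.eval (toData a).size

section Bounds

variable {α β γ : Type} [ToData α] [ToData β] [ToData γ]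

theorem PolyBounded.mono {f g : α → ℕ} (hg : PolyBounded g) (h : ∀ a, f a ≤ g a) :
    PolyBounded f := by
  obtain ⟨Q, hQ⟩ := hg
  exact ⟨Q, fun a => (h a).trans (hQ a)⟩

theorem PolyBounded.const (k : ℕ) : PolyBounded fun _ : α => k :=
  ⟨Polynomial.C k, fun a => by simp⟩

theorem PolyBounded.size : PolyBounded fun a : α => (toData a).size :=
  ⟨Polynomial.X, fun a => by simp⟩

theorem PolyBounded.add {f g : α → ℕ} (hf : PolyBounded f) (hg : PolyBounded g) :
    PolyBounded fun a => f a + g a := by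
  obtain ⟨P, hP⟩ := hf
  obtain ⟨Q, hQ⟩ := hg
  exact ⟨P + Q, fun a => by rw [Polynomial.eval_add]; exact add_le_add (hP a) (hQ a)⟩

theorem PolyBounded.mul {f g : α → ℕ} (hf : PolyBounded f) (hg : PolyBounded g) :
    PolyBounded fun a => f a * g a := by
  obtain ⟨P, hP⟩ := hf
  obtain ⟨Q, hQ⟩ := hg
  exact ⟨P * Q, fun a => by rw [Polynomial.eval_mul]; exact Nat.mul_le_mul (hP a) (hQ a)⟩

theorem PolyBounded.eval (Q : Polynomial ℕ) {f : α → ℕ} (hf : PolyBounded f) :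
    PolyBounded fun a => Q.eval (f a) := by
  obtain ⟨P, hP⟩ := hf
  exact ⟨Q.comp P, fun a => by rw [Polynomial.eval_comp]; exact eval_natPoly_mono Q (hP a)⟩

/-- Costs are carried as functions of the input, and closure of `PolyBounded` replaces the
computation of explicit polynomials. -/
theorem PolyTime.of_runs {f : α → β} (p : Prog) (T : α → ℕ) (hT : PolyBounded T)
    (h : ∀ a, ∃ t ≤ T a, Runs p (toData a) (toData (f a)) t) : PolyTime f := by
  obtain ⟨Q, hQ⟩ := hT
  refine ⟨p, Q, fun a => ?_⟩
  obtain ⟨t, ht, hr⟩ := h a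
  exact ⟨t, ht.trans (hQ a), hr⟩

theorem PolyTime.exists_runs {f : α → β} (hf : PolyTime f) :
    ∃ (p : Prog) (T : α → ℕ), PolyBounded T ∧ ∀ a, Runs p (toData a) (toData (f a)) (T a) := by
  obtain ⟨p, Q, h⟩ := hf
  choose T hT hr using h
  exact ⟨p, T, ⟨Q, hT⟩, hr⟩

theorem PolyTime.polyBounded_size {f : α → β} (hf : PolyTime f) :
    PolyBounded fun a => (toData (f a)).size := by
  obtain ⟨p, T, hT, hr⟩ := hf.exists_runs
  exact hT.mono fun a => (hr a).size_le

theorem PolyBounded.comp {g : β → ℕ} {f : α → β} (hg : PolyBounded g) (hf : PolyTime f) :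
    PolyBounded fun a => g (f a) := by
  obtain ⟨Q, hQ⟩ := hg
  exact (hf.polyBounded_size.eval Q).mono fun a => hQ (f a)

/-! ### Closure properties of polynomial time -/

/-- Programs see only encodings, so the codomain may change freely, for instance between `Unary` and
lists of ones. -/
theorem PolyTime.of_toData_eq {f : α → β} {g : α → γ} (hf : PolyTime f)
    (h : ∀ a, toData (f a) = toData (g a)) : PolyTime g := by
  obtain ⟨p, Q, hp⟩ := hf
  exact ⟨p, Q, fun a => by rw [← h a]; exact hp a⟩

theorem PolyTime.of_instr {f : α → β} (i : Instr) (h : ∀ a, i.eval (toData a) = toData (f a))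
    (hb : PolyBounded fun a => (toData (f a)).size) : PolyTime f :=
  .of_runs (.instr i) _ (PolyBounded.size.add hb) fun a =>
    ⟨_, le_rfl, by simpa only [h a] using Runs.instr i (toData a)⟩

theorem PolyTime.id : PolyTime fun a : α => a :=
  .of_instr .id (fun _ => rfl) PolyBounded.size

theorem PolyTime.comp {g : β → γ} {f : α → β} (hg : PolyTime g) (hf : PolyTime f) :
    PolyTime fun a => g (f a) := by
  obtain ⟨p, T, hT, hr⟩ := hf.exists_runs
  obtain ⟨q, U, hU, hs⟩ := hg.exists_runs
  exact .of_runs (.seq p q) _ (hT.add (hU.comp hf)) fun a => ⟨_, le_rfl, (hr a).seq (hs (f a))⟩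

theorem PolyTime.mk {f : α → β} {g : α → γ} (hf : PolyTime f) (hg : PolyTime g) :
    PolyTime fun a => (f a, g a) := by
  obtain ⟨p, T, hT, hr⟩ := hf.exists_runs
  obtain ⟨q, U, hU, hs⟩ := hg.exists_runs
  exact .of_runs (.pair p q) _ ((hT.add hU).add (.const 1)) fun a =>
    ⟨_, le_rfl, (hr a).pair (hs a)⟩

theorem PolyTime.const_data (d : Data) : PolyTime fun _ : α => d := by
  induction d with
  | num k => exact .of_instr (.const k) (fun _ => rfl) (.const _)
  | pair a b ha hb => exact (ha.mk hb).of_toData_eq fun _ => rfl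

theorem PolyTime.const (b : β) : PolyTime fun _ : α => b :=
  (PolyTime.const_data (toData b)).of_toData_eq fun _ => rfl

theorem PolyTime.fst {f : α → β × γ} (hf : PolyTime f) : PolyTime fun a => (f a).1 :=
  PolyTime.comp (g := Prod.fst)
    (.of_instr .fst (fun _ => rfl) (PolyBounded.size.mono fun a => by
      change _ ≤ (toData a.1).size + _ + 1; omega)) hf

theorem PolyTime.snd {f : α → β × γ} (hf : PolyTime f) : PolyTime fun a => (f a).2 :=
  PolyTime.comp (g := Prod.snd)
    (.of_instr .snd (fun _ => rfl) (PolyBounded.size.mono fun a => by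
      change _ ≤ _ + (toData a.2).size + 1; omega)) hf

theorem PolyTime.test {c : α → γ} {f g : α → β} (hc : PolyTime c) (hf : PolyTime f)
    (hg : PolyTime g) (b : α → Bool) (hb : ∀ a, b a = true ↔ toData (c a) ≠ .num 0) :
    PolyTime fun a => cond (b a) (f a) (g a) := by
  obtain ⟨p, T, hT, hr⟩ := hc.exists_runs
  obtain ⟨q, U, hU, hs⟩ := hf.exists_runs
  obtain ⟨w, V, hV, hv⟩ := hg.exists_runs
  refine .of_runs (.ite p q w) _ (hT.add (hU.add hV)) fun a => ?_
  by_cases h : toData (c a) = .num 0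
  · have : b a = false := by simpa using (hb a).not.2 (by simpa using h)
    refine ⟨T a + V a, by omega, ?_⟩
    rw [this]
    exact Runs.iteFalse (by simpa [h] using hr a) (hv a)
  · have : b a = true := (hb a).2 h
    refine ⟨T a + U a, by omega, ?_⟩
    rw [this]
    exact Runs.iteTrue (hr a) h (hs a)

theorem toData_bool_ne (b : Bool) : b = true ↔ toData b ≠ .num 0 := by
  cases b <;> simp [toData]

theorem PolyTime.cond {c : α → Bool} {f g : α → β} (hc : PolyTime c) (hf : PolyTime f)
    (hg : PolyTime g) : PolyTime fun a => cond (c a) (f a) (g a) :=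
  hc.test hf hg c fun a => toData_bool_ne (c a)

theorem toData_nat (n : ℕ) : toData n = .num n := rfl

theorem size_toData_nat (n : ℕ) : (toData n).size = n.size + 1 := rfl

theorem PolyTime.decide_eq_zero {f : α → ℕ} (hf : PolyTime f) :
    PolyTime fun a => decide (f a = 0) := by
  have := hf.test (PolyTime.const false) (PolyTime.const true) (fun a => decide (f a ≠ 0))
    (by simp [toData_nat])
  refine this.of_toData_eq fun a => ?_
  by_cases h : f a = 0 <;> simp [h]

end Bounds

/-! ### Loops -/

/-- There are `m` rounds of one test and one body, each of cost at most `B`, then a last failing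
test, which also pays for copying out the state. -/
theorem Runs.while_iterate {c f : Prog} (s v : ℕ → Data) (B m : ℕ)
    (h : ∀ k < m, v k ≠ .num 0 ∧ (∃ t ≤ B, Runs c (s k) (v k) t) ∧
      ∃ t ≤ B, Runs f (s k) (s (k + 1)) t)
    (hm : ∃ t ≤ B, Runs c (s m) (.num 0) t) :
    ∃ t ≤ 2 * B * m + B + (s m).size, Runs (.while c f) (s 0) (s m) t := by
  induction m generalizing s v with
  | zero =>
    obtain ⟨t, ht, hr⟩ := hm
    exact ⟨_, by omega, Runs.whileFalse hr⟩
  | succ m ih =>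
    obtain ⟨hv, ⟨t₁, h₁, r₁⟩, t₂, h₂, r₂⟩ := h 0 (by omega)
    obtain ⟨t₃, h₃, r₃⟩ := ih (fun k => s (k + 1)) (fun k => v (k + 1))
      (fun k hk => h (k + 1) (by omega)) hm
    refine ⟨_, ?_, Runs.whileTrue r₁ hv r₂ r₃⟩
    rw [Nat.mul_succ]
    omega

section Fold

variable {α β σ : Type} [ToData α] [ToData β] [ToData σ]

theorem toData_cons (b : β) (l : List β) : toData (b :: l) = .pair (toData b) (toData l) := rfl

theorem toData_nil : toData ([] : List β) = .num 0 := rfl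

theorem size_toData_list (l : List β) :
    (toData l).size = (l.map fun b => (toData b).size + 1).sum + 1 := by
  induction l with
  | nil => simp [toData_nil, Data.size]
  | cons b l ih => rw [toData_cons, Data.size, ih, List.map_cons, List.sum_cons]; omega

theorem length_le_size (l : List β) : l.length ≤ (toData l).size := by
  induction l with
  | nil => simp
  | cons b l ih => rw [toData_cons, Data.size, List.length_cons]; omega

theorem size_le_of_mem {l : List β} {b : β} (h : b ∈ l) : (toData b).size ≤ (toData l).size := by
  rw [size_toData_list]
  have := List.le_sum_of_mem (List.mem_map_of_mem (f := fun b => (toData b).size + 1) h)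
  omega

theorem size_le_of_sublist {l₁ l₂ : List β} (h : l₁.Sublist l₂) :
    (toData l₁).size ≤ (toData l₂).size := by
  induction h with
  | slnil => simp
  | cons b _ ih => rw [toData_cons b, Data.size]; omega
  | cons_cons b _ ih => rw [toData_cons b, toData_cons b, Data.size, Data.size]; omega

theorem size_list_le {l : List β} {B : ℕ} (h : ∀ b ∈ l, (toData b).size ≤ B) :
    (toData l).size ≤ l.length * (B + 1) + 1 := by
  induction l with
  | nil => simp [toData_nil, Data.size]
  | cons b l ih =>
    have h₁ := h b (by simp)
    have h₂ := ih fun x hx => h x (by simp [hx])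
    rw [toData_cons, Data.size, List.length_cons, Nat.succ_mul]
    omega

theorem size_toData_prod (x : α × β) :
    (toData x).size = (toData x.1).size + (toData x.2).size + 1 := rfl

/-- A polynomial-time step iterated along a list can still blow up, as repeated squaring does. Hence
the hypothesis `hb`, a polynomial bound on the accumulator after every prefix of the list; the
number of steps is bounded by the size of the list. -/
theorem PolyTime.foldl {step : α → σ → β → σ}
    (hs : PolyTime fun x : α × σ × β => step x.1 x.2.1 x.2.2) {init : α → σ} {l : α → List β}
    (hi : PolyTime init) (hl : PolyTime l)
    (hb : ∃ S : α → ℕ, PolyBounded S ∧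
      ∀ a l₁, l₁ <+: l a → (toData (l₁.foldl (step a) (init a))).size ≤ S a) :
    PolyTime fun a => (l a).foldl (step a) (init a) := by
  obtain ⟨S, hS, hb⟩ := hb
  obtain ⟨p, T, ⟨Q, hQ⟩, hr⟩ := hs.exists_runs
  -- a loop state is `(remaining list, (a, accumulator))`
  let rearr : Prog := .pair (.seq (.instr .snd) (.instr .fst))
    (.pair (.seq (.instr .snd) (.instr .snd)) (.seq (.instr .fst) (.instr .fst)))
  let body : Prog := .pair (.seq (.instr .fst) (.instr .snd))
    (.pair (.seq (.instr .snd) (.instr .fst)) (.seq rearr p))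
  let acc : α → ℕ → σ := fun a k => ((l a).take k).foldl (step a) (init a)
  let st : α → ℕ → Data := fun a k =>
    .pair (toData ((l a).drop k)) (.pair (toData a) (toData (acc a k)))
  let E : α → ℕ := fun a => (toData (l a)).size + (toData a).size + S a + 2
  have hE : PolyBounded E :=
    ((hl.polyBounded_size.add PolyBounded.size).add hS).add (.const 2)
  -- The factor `30` is slack for the projections and pairings that rearrange the state; `Q` pays
  -- for the step itself.
  let B : α → ℕ := fun a => 30 * E a + Q.eval (E a)
  have hB : PolyBounded B := ((PolyBounded.const 30).mul hE).add (hE.eval Q)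
  have hacc : ∀ a k, (toData (acc a k)).size ≤ S a := fun a k => hb a _ (List.take_prefix _ _)
  have hdrop : ∀ a k, (toData ((l a).drop k)).size ≤ (toData (l a)).size :=
    fun a k => size_le_of_sublist (List.drop_sublist _ _)
  have hloop : PolyTime (β := Data) fun a => st a (l a).length := by
    have hinit : PolyTime fun a => (l a, a, init a) := hl.mk (PolyTime.id.mk hi)
    obtain ⟨q, U, hU, hq⟩ := hinit.exists_runs
    -- The remaining list serves as the test: a nonempty list is encoded by a pair, the empty one by
    -- `0`.
    refine .of_runs (.seq q (.while (.instr .fst) body))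
      (fun a => U a + (2 * B a * (toData (l a)).size + B a + E a))
      (hU.add (((((PolyBounded.const 2).mul hB).mul hl.polyBounded_size).add hB).add hE))
      fun a => ?_
    have hend : (st a (l a).length).size ≤ E a := by
      have := hacc a (l a).length
      have := hdrop a (l a).length
      simp only [st, E, Data.size]; omega
    have hwhile := Runs.while_iterate (c := .instr .fst) (f := body) (st a)
      (fun k => toData ((l a).drop k)) (B a) (l a).length
    obtain ⟨t, ht, hw⟩ := hwhile (by
      intro k hk
      have hd : (l a).drop k = (l a)[k] :: (l a).drop (k + 1) := List.drop_eq_getElem_cons hk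
      have hsk := hdrop a k
      have hak := hacc a k
      have hak' := hacc a (k + 1)
      have hstep : step a (acc a k) (l a)[k] = acc a (k + 1) := by
        simp only [acc, List.take_add_one, List.getElem?_eq_getElem hk, List.foldl_append]
        rfl
      have hbk : (toData (l a)[k]).size + (toData ((l a).drop (k + 1))).size + 1
          ≤ (toData (l a)).size := by
        rw [hd, toData_cons, Data.size] at hsk; exact hsk
      refine ⟨?_, ⟨_, ?_, Runs.instr .fst _⟩, ?_⟩
      · simp only [hd, toData_cons]; exact fun h => by cases h
      · simp only [st, Instr.eval, Data.size, B, E]; omega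
      · have hrun := hr (a, acc a k, (l a)[k])
        simp only [hstep] at hrun
        have hT := hQ (a, acc a k, (l a)[k])
        have hsz : (toData (a, acc a k, (l a)[k])).size ≤ E a := by
          rw [size_toData_prod, size_toData_prod]; simp only [E]; omega
        have hT' := hT.trans (eval_natPoly_mono Q hsz)
        simp only [st, hd, toData_cons]
        refine ⟨_, ?_, Runs.pair (Runs.seq (Runs.instr .fst _) (Runs.instr .snd _))
          (Runs.pair (Runs.seq (Runs.instr .snd _) (Runs.instr .fst _))
            (Runs.seq (Runs.pair (Runs.seq (Runs.instr .snd _) (Runs.instr .fst _))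
              (Runs.pair (Runs.seq (Runs.instr .snd _) (Runs.instr .snd _))
                (Runs.seq (Runs.instr .fst _) (Runs.instr .fst _)))) hrun))⟩
        simp only [Instr.eval, Data.size, B, E] at *
        omega) (by
      have hrun := Runs.instr .fst (st a (l a).length)
      have hz : Instr.eval .fst (st a (l a).length) = .num 0 := by
        simp [st, Instr.eval, toData_nil]
      rw [hz] at hrun
      refine ⟨_, ?_, hrun⟩
      simp only [Instr.eval, st, Data.size, B, E] at *
      have := hdrop a (l a).length
      have := hacc a (l a).length
      have : 1 ≤ (toData (l a)).size := Data.one_le_size _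
      simp only [List.drop_length, toData_nil, Data.size, Nat.size_zero] at *
      omega)
    refine ⟨U a + t, ?_, Runs.seq (hq a) hw⟩
    have := Nat.mul_le_mul_left (2 * B a) (length_le_size (l a))
    omega
  have hfin : PolyTime fun a => ((l a).drop (l a).length, a, acc a (l a).length) :=
    hloop.of_toData_eq fun a => rfl
  refine hfin.snd.snd.of_toData_eq fun a => ?_
  simp [acc]

end Fold

attribute [fun_prop] PolyTime PolyTime.id PolyTime.comp PolyTime.const PolyTime.mk PolyTime.fst
  PolyTime.snd PolyTime.cond PolyTime.decide_eq_zero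

/-! ### Arithmetic and Boolean operations in polynomial time -/

section Arithmetic

variable {α β γ : Type} [ToData α] [ToData β] [ToData γ]

theorem size_add_le (a b : ℕ) : (a + b).size ≤ a.size + b.size + 1 := by
  rw [Nat.size_le, pow_succ, pow_add]
  have ha := Nat.lt_size_self a
  have hb := Nat.lt_size_self b
  have ha1 : 1 ≤ 2 ^ a.size := Nat.one_le_two_pow
  have hb1 : 1 ≤ 2 ^ b.size := Nat.one_le_two_pow
  nlinarith

theorem size_mul_le (a b : ℕ) : (a * b).size ≤ a.size + b.size := by
  rw [Nat.size_le, pow_add]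
  have ha := Nat.lt_size_self a
  have hb := Nat.lt_size_self b
  exact Nat.mul_lt_mul'' ha hb

theorem PolyTime.of_arith {op : ℕ → ℕ → ℕ} {f g : α → ℕ} (i : Instr)
    (hi : ∀ a b, i.eval (.pair (.num a) (.num b)) = .num (op a b))
    (hb : ∀ a b, (op a b).size ≤ a.size + b.size + 1) (hf : PolyTime f) (hg : PolyTime g) :
    PolyTime fun a => op (f a) (g a) :=
  PolyTime.comp (g := fun x : ℕ × ℕ => op x.1 x.2)
    (.of_instr i (fun x => hi x.1 x.2) (PolyBounded.size.mono fun x => by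
      rw [size_toData_prod, size_toData_nat, size_toData_nat, size_toData_nat]
      have := hb x.1 x.2
      omega)) (hf.mk hg)

@[fun_prop]
theorem PolyTime.add {f g : α → ℕ} (hf : PolyTime f) (hg : PolyTime g) :
    PolyTime fun a => f a + g a :=
  .of_arith .add (fun _ _ => rfl) size_add_le hf hg

@[fun_prop]
theorem PolyTime.sub {f g : α → ℕ} (hf : PolyTime f) (hg : PolyTime g) :
    PolyTime fun a => f a - g a :=
  .of_arith .sub (fun _ _ => rfl)
    (fun a b => (Nat.size_le_size (Nat.sub_le a b)).trans (by omega)) hf hg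

@[fun_prop]
theorem PolyTime.mul {f g : α → ℕ} (hf : PolyTime f) (hg : PolyTime g) :
    PolyTime fun a => f a * g a :=
  .of_arith .mul (fun _ _ => rfl) (fun a b => (size_mul_le a b).trans (by omega)) hf hg

@[fun_prop]
theorem PolyTime.div {f g : α → ℕ} (hf : PolyTime f) (hg : PolyTime g) :
    PolyTime fun a => f a / g a :=
  .of_arith .div (fun _ _ => rfl)
    (fun a b => (Nat.size_le_size (Nat.div_le_self a b)).trans (by omega)) hf hg

@[fun_prop]
theorem PolyTime.mod {f g : α → ℕ} (hf : PolyTime f) (hg : PolyTime g) :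
    PolyTime fun a => f a % g a :=
  .of_arith .mod (fun _ _ => rfl)
    (fun a b => (Nat.size_le_size (Nat.mod_le a b)).trans (by omega)) hf hg

@[fun_prop]
theorem PolyTime.decide_eq {f g : α → ℕ} (hf : PolyTime f) (hg : PolyTime g) :
    PolyTime fun a => decide (f a = g a) := by
  -- Subtraction is truncated, so equality needs both differences to vanish.
  have : PolyTime fun a => decide (f a - g a + (g a - f a) = 0) := by fun_prop
  refine this.of_toData_eq fun a => ?_
  congr 2
  exact propext (by omega)

@[fun_prop]
theorem PolyTime.decide_le {f g : α → ℕ} (hf : PolyTime f) (hg : PolyTime g) :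
    PolyTime fun a => decide (f a ≤ g a) := by
  have : PolyTime fun a => decide (f a - g a = 0) := by fun_prop
  refine this.of_toData_eq fun a => ?_
  congr 2
  exact propext (by omega)

@[fun_prop]
theorem PolyTime.decide_lt {f g : α → ℕ} (hf : PolyTime f) (hg : PolyTime g) :
    PolyTime fun a => decide (f a < g a) := by
  have : PolyTime fun a => decide (f a + 1 ≤ g a) := by fun_prop
  exact this

@[fun_prop]
theorem PolyTime.and {f g : α → Bool} (hf : PolyTime f) (hg : PolyTime g) :
    PolyTime fun a => f a && g a := by
  have : PolyTime fun a => bif f a then g a else false := by fun_prop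
  exact this.of_toData_eq fun a => by cases f a <;> rfl

@[fun_prop]
theorem PolyTime.beq {f g : α → Bool} (hf : PolyTime f) (hg : PolyTime g) :
    PolyTime fun a => f a == g a := by
  have : PolyTime fun a => bif f a then g a else (bif g a then false else true) := by fun_prop
  exact this.of_toData_eq fun a => by cases f a <;> cases g a <;> rfl

end Arithmetic

/-! ### List operations in polynomial time -/

section Lists

variable {α β γ σ : Type} [ToData α] [ToData β] [ToData γ] [ToData σ]

@[fun_prop]
theorem PolyTime.cons {f : α → β} {l : α → List β} (hf : PolyTime f) (hl : PolyTime l) :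
    PolyTime fun a => f a :: l a :=
  (hf.mk hl).of_toData_eq fun _ => rfl

theorem foldl_cons_eq {β : Type} (l m : List β) :
    l.foldl (fun s b => b :: s) m = l.reverse ++ m := by
  induction l generalizing m with
  | nil => rfl
  | cons b l ih => simp [ih]

@[fun_prop]
theorem PolyTime.reverse {l : α → List β} (hl : PolyTime l) : PolyTime fun a => (l a).reverse := by
  have : PolyTime fun a => (l a).foldl (fun s b => b :: s) [] := by
    refine .foldl (by fun_prop) (.const _) hl ⟨_, hl.polyBounded_size, fun a l₁ h => ?_⟩
    refine le_trans (le_of_eq ?_) (size_le_of_sublist h.sublist)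
    rw [foldl_cons_eq, List.append_nil, size_toData_list, size_toData_list,
      List.map_reverse, List.sum_reverse]
  exact this.of_toData_eq fun a => by simp

@[fun_prop]
theorem PolyTime.append {l m : α → List β} (hl : PolyTime l) (hm : PolyTime m) :
    PolyTime fun a => l a ++ m a := by
  have : PolyTime fun a => (l a).reverse.foldl (fun s b => b :: s) (m a) := by
    refine .foldl (by fun_prop) hm (by fun_prop)
      ⟨_, hl.reverse.polyBounded_size.add hm.polyBounded_size, fun a l₁ h => ?_⟩
    have := size_le_of_sublist h.sublist
    rw [foldl_cons_eq, size_toData_list]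
    rw [size_toData_list] at this
    rw [size_toData_list (m a), List.map_append, List.sum_append, List.map_reverse,
      List.sum_reverse]
    omega
  exact this.of_toData_eq fun a => by simp

@[fun_prop]
theorem PolyTime.map {f : α → β → γ} {l : α → List β} (hf : PolyTime fun x : α × β => f x.1 x.2)
    (hl : PolyTime l) : PolyTime fun a => (l a).map (f a) := by
  obtain ⟨Q, hQ⟩ := hf.polyBounded_size
  have : PolyTime fun a => ((l a).foldl (fun s b => f a b :: s) []).reverse := by
    refine PolyTime.reverse (.foldl (step := fun a s b => f a b :: s) ?_ (.const _) hl
      ⟨fun a => (toData (l a)).size * (Q.eval ((toData a).size + (toData (l a)).size + 1) + 1) + 1,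
        ?_, fun a l₁ h => ?_⟩)
    · exact .cons (hf.comp (f := fun x : α × List γ × β => (x.1, x.2.2)) (by fun_prop))
        (by fun_prop)
    · exact (hl.polyBounded_size.mul ((((PolyBounded.size.add hl.polyBounded_size).add
        (.const 1)).eval Q).add (.const 1))).add (.const 1)
    · have hfold : l₁.foldl (fun s b => f a b :: s) [] = (l₁.map (f a)).reverse := by
        rw [← List.foldl_map (f := f a) (g := fun s b => b :: s), foldl_cons_eq, List.append_nil]
      rw [hfold]
      have hlen := (h.length_le).trans (length_le_size (l a))
      refine (size_list_le (B := Q.eval ((toData a).size + (toData (l a)).size + 1)) ?_).trans ?_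
      · intro c hc
        simp only [List.mem_reverse, List.mem_map] at hc
        obtain ⟨b, hb, rfl⟩ := hc
        refine (hQ (a, b)).trans (eval_natPoly_mono Q ?_)
        have := size_le_of_mem (h.subset hb)
        simp only [size_toData_prod]; omega
      · rw [List.length_reverse, List.length_map]
        exact Nat.add_le_add_right (Nat.mul_le_mul_right _ hlen) 1
  refine this.of_toData_eq fun a => ?_
  rw [← List.foldl_map (f := f a) (g := fun s b => b :: s), foldl_cons_eq]
  simp

theorem foldl_count {β σ : Type} (l : List β) (f : σ → σ) (s : σ) :
    l.foldl (fun s _ => f s) s = f^[l.length] s := by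
  induction l generalizing s with
  | nil => rfl
  | cons b l ih => rw [List.foldl_cons, ih, List.length_cons, Function.iterate_succ_apply]

theorem size_le_self (k : ℕ) : k.size ≤ k :=
  Nat.size_le.2 Nat.lt_two_pow_self

@[fun_prop]
theorem PolyTime.length {l : α → List β} (hl : PolyTime l) : PolyTime fun a => (l a).length := by
  have hfold : ∀ l : List β, l.foldl (fun s _ => s + 1) 0 = l.length := fun l => by
    rw [foldl_count l (fun s => s + 1)]; simp
  have : PolyTime fun a => (l a).foldl (fun s _ => s + 1) 0 := by
    refine .foldl (by fun_prop) (.const _) hl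
      ⟨_, hl.polyBounded_size.add (.const 1), fun a l₁ h => ?_⟩
    have := (h.length_le).trans (length_le_size (l a))
    rw [hfold, size_toData_nat]
    have := size_le_self l₁.length
    omega
  exact this.of_toData_eq fun a => by rw [hfold]

@[fun_prop]
-- The exponent is the length of a list, that is, given in unary; for a binary exponent the result
-- would be exponentially long.
theorem PolyTime.two_pow_length {l : α → List β} (hl : PolyTime l) :
    PolyTime fun a => 2 ^ (l a).length := by
  have hfold : ∀ l : List β, l.foldl (fun s _ => s * 2) 1 = 2 ^ l.length := fun l => by
    rw [foldl_count l (fun s => s * 2)]; simp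
  have : PolyTime fun a => (l a).foldl (fun s _ => s * 2) 1 := by
    refine .foldl (by fun_prop) (.const _) hl
      ⟨_, hl.polyBounded_size.add (.const 2), fun a l₁ h => ?_⟩
    have := (h.length_le).trans (length_le_size (l a))
    rw [hfold, size_toData_nat, Nat.size_pow]
    omega
  exact this.of_toData_eq fun a => by rw [hfold]

theorem PolyTime.range_length {l : α → List β} (hl : PolyTime l) :
    PolyTime fun a => List.range (l a).length := by
  have hfold : ∀ l : List β, l.foldl (fun (s : ℕ × List ℕ) _ => (s.1 + 1, s.1 :: s.2)) (0, [])
      = (l.length, (List.range l.length).reverse) := fun l => by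
    rw [foldl_count l (fun s : ℕ × List ℕ => (s.1 + 1, s.1 :: s.2))]
    induction l.length with
    | zero => rfl
    | succ k ih => rw [Function.iterate_succ_apply', ih, List.range_succ]; simp
  have : PolyTime fun a => (l a).foldl
      (fun (s : ℕ × List ℕ) _ => (s.1 + 1, s.1 :: s.2)) (0, []) := by
    refine .foldl (by fun_prop) (.const _) hl
      ⟨fun a => (toData (l a)).size + 1 + ((toData (l a)).size * ((toData (l a)).size + 1 + 1) + 1)
        + 1, ?_, fun a l₁ h => ?_⟩
    · have h := hl.polyBounded_size
      exact (((h.add (.const 1)).add ((h.mul ((h.add (.const 1)).add (.const 1))).add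
        (.const 1))).add (.const 1))
    have hlen := (h.length_le).trans (length_le_size (l a))
    rw [hfold, size_toData_prod, size_toData_nat]
    have h₁ := size_le_self l₁.length
    have h₂ := size_list_le (l := (List.range l₁.length).reverse)
      (B := (toData (l a)).size + 1) fun b hb => by
        simp only [List.mem_reverse, List.mem_range] at hb
        have := size_le_self b
        rw [size_toData_nat]; omega
    rw [List.length_reverse, List.length_range] at h₂
    have h₃ := Nat.mul_le_mul_right ((toData (l a)).size + 1 + 1) hlen
    simp only
    omega
  exact this.snd.reverse.of_toData_eq fun a => by rw [hfold]; simp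

/-- Lookup as a fold: the counter `j` is the current position, and the default `x` survives unless
position `i` is met. -/
theorem foldl_getD {β : Type} (l : List β) (i j : ℕ) (x : β) :
    (l.foldl (fun (s : ℕ × β) b => (s.1 + 1, bif decide (s.1 = i) then b else s.2)) (j, x)).2
      = if j ≤ i then l.getD (i - j) x else x := by
  induction l generalizing j x with
  | nil => simp
  | cons b l ih =>
    rw [List.foldl_cons, ih]
    rcases lt_trichotomy j i with h | rfl | h
    · have h₁ : i - j = i - (j + 1) + 1 := by omega
      rw [h₁, List.getD_cons_succ]
      simp [h.ne, h.le, Nat.succ_le_of_lt h]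
    · simp
    · simp [h.ne', h.not_ge, show ¬ j + 1 ≤ i by omega]

@[fun_prop]
theorem PolyTime.getD {l : α → List β} {i : α → ℕ} {x : α → β} (hl : PolyTime l)
    (hi : PolyTime i) (hx : PolyTime x) : PolyTime fun a => (l a).getD (i a) (x a) := by
  have : PolyTime fun a => (l a).foldl
      (fun (s : ℕ × β) b => (s.1 + 1, bif decide (s.1 = i a) then b else s.2)) (0, x a) := by
    refine .foldl (by fun_prop) (by fun_prop) hl
      ⟨fun a => (toData (l a)).size + 1 + ((toData (l a)).size + (toData (x a)).size) + 1,
        ?_, fun a l₁ h => ?_⟩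
    · have h := hl.polyBounded_size
      exact ((h.add (.const 1)).add (h.add hx.polyBounded_size)).add (.const 1)
    have hlen := (h.length_le).trans (length_le_size (l a))
    have hfst : ∀ (l : List β) (s : ℕ × β), (l.foldl (fun (s : ℕ × β) b =>
        (s.1 + 1, bif decide (s.1 = i a) then b else s.2)) s).1 = s.1 + l.length := by
      intro l
      induction l with
      | nil => simp
      | cons b l ih => intro s; rw [List.foldl_cons, ih]; simp only [List.length_cons]; omega
    rw [size_toData_prod, hfst, foldl_getD, size_toData_nat, if_pos (Nat.zero_le _)]
    have h₁ := size_le_self (0 + l₁.length)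
    have h₂ : (toData (l₁.getD (i a - 0) (x a))).size
        ≤ (toData (l a)).size + (toData (x a)).size := by
      rcases lt_or_ge (i a - 0) l₁.length with h' | h'
      · rw [List.getD_eq_getElem _ _ h']
        have := size_le_of_mem (h.subset (List.getElem_mem h'))
        omega
      · rw [List.getD_eq_default _ _ h']; omega
    simp only
    omega
  exact this.snd.of_toData_eq fun a => by rw [foldl_getD]; simp

theorem size_sum_le (l : List ℕ) : l.sum.size + 1 ≤ (toData l).size := by
  induction l with
  | nil => simp [toData_nil, Data.size]
  | cons a l ih =>
    rw [toData_cons, Data.size, List.sum_cons, size_toData_nat]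
    have := size_add_le a l.sum
    omega

@[fun_prop]
theorem PolyTime.sum {l : α → List ℕ} (hl : PolyTime l) : PolyTime fun a => (l a).sum := by
  have : PolyTime fun a => (l a).foldl (fun s b => s + b) 0 := by
    refine .foldl (by fun_prop) (.const _) hl ⟨_, hl.polyBounded_size, fun a l₁ h => ?_⟩
    rw [← List.sum_eq_foldl]
    exact (size_sum_le _).trans (size_le_of_sublist h.sublist)
  exact this.of_toData_eq fun a => by rw [← List.sum_eq_foldl]

@[fun_prop]
theorem PolyTime.all {f : α → β → Bool} {l : α → List β}
    (hf : PolyTime fun x : α × β => f x.1 x.2) (hl : PolyTime l) :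
    PolyTime fun a => (l a).all (f a) := by
  have hm : PolyTime fun a => (l a).map (f a) := by fun_prop
  have : PolyTime fun a => ((l a).map (f a)).foldl (fun s b => s && b) true := by
    refine .foldl (by fun_prop) (.const _) hm ⟨_, .const 2, fun a l₁ h => ?_⟩
    cases l₁.foldl (fun s b => s && b) true <;> simp [toData, Data.size]
  refine this.of_toData_eq fun a => ?_
  have : ∀ (l : List β) (c : Bool),
      (l.map (f a)).foldl (fun s b => s && b) c = (c && l.all (f a)) := by
    intro l
    induction l with
    | nil => simp
    | cons b l ih => intro c; simp [ih, Bool.and_assoc]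
  rw [this, Bool.true_and]

/-! ### Unary parameters -/

@[fun_prop]
theorem PolyTime.len_list {u : α → Unary} (hu : PolyTime u) :
    PolyTime fun a => List.replicate (u a).len (1 : ℕ) :=
  hu.of_toData_eq fun _ => rfl

@[fun_prop]
theorem PolyTime.len {u : α → Unary} (hu : PolyTime u) : PolyTime fun a => (u a).len := by
  have : PolyTime fun a => (List.replicate (u a).len (1 : ℕ)).length := by fun_prop
  exact this.of_toData_eq fun a => by simp

@[fun_prop]
theorem PolyTime.range_len {u : α → Unary} (hu : PolyTime u) :
    PolyTime fun a => List.range (u a).len := by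
  have := hu.len_list.range_length
  exact this.of_toData_eq fun a => by simp

@[fun_prop]
theorem PolyTime.two_pow_len {u : α → Unary} (hu : PolyTime u) :
    PolyTime fun a => 2 ^ (u a).len := by
  have := hu.len_list.two_pow_length
  exact this.of_toData_eq fun a => by simp

theorem EfficientParam.of_list {N : ℕ → ℕ}
    (h : PolyTime fun u : Unary => List.replicate (N u.len) (1 : ℕ)) : EfficientParam N :=
  PolyTime.of_toData_eq h fun _ => rfl

theorem EfficientParam.const (k : ℕ) : EfficientParam fun _ => k :=
  PolyTime.const _

theorem EfficientParam.id : EfficientParam fun k => k :=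
  PolyTime.id

theorem EfficientParam.add {N M : ℕ → ℕ} (hN : EfficientParam N) (hM : EfficientParam M) :
    EfficientParam fun k => N k + M k := by
  have : PolyTime fun u : Unary =>
      List.replicate (N u.len) (1 : ℕ) ++ List.replicate (M u.len) 1 :=
    (PolyTime.len_list hN).append (PolyTime.len_list hM)
  exact .of_list (this.of_toData_eq fun u => by rw [← List.replicate_add])

/-- Each entry costs `2` for the leaf and `1` for its pair; the closing `0` costs `1`. -/
theorem size_replicate_one (k : ℕ) : (toData (List.replicate k (1 : ℕ))).size = 3 * k + 1 := by
  rw [size_toData_list]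
  simp [size_toData_nat]
  ring

theorem EfficientParam.mul {N M : ℕ → ℕ} (hN : EfficientParam N) (hM : EfficientParam M) :
    EfficientParam fun k => N k * M k := by
  have hN' := PolyTime.len_list hN
  have hM' := PolyTime.len_list hM
  have hfold : ∀ (u : Unary) (l : List ℕ),
      l.foldl (fun s _ => s ++ List.replicate (M u.len) (1 : ℕ)) []
        = List.replicate (l.length * M u.len) 1 := fun u l => by
    rw [foldl_count l (fun s => s ++ List.replicate (M u.len) (1 : ℕ))]
    induction l.length with
    | zero => simp
    | succ k ih => rw [Function.iterate_succ_apply', ih, ← List.replicate_add, Nat.succ_mul]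
  have : PolyTime fun u : Unary => (List.replicate (N u.len) (1 : ℕ)).foldl
      (fun s _ => s ++ List.replicate (M u.len) (1 : ℕ)) [] := by
    refine .foldl (step := fun u s _ => s ++ List.replicate (M u.len) (1 : ℕ)) ?_ (.const _) hN'
      ⟨fun u => 3 * ((toData (List.replicate (N u.len) (1 : ℕ))).size
        * (toData (List.replicate (M u.len) (1 : ℕ))).size) + 1, ?_, fun u l₁ h => ?_⟩
    · exact .append (by fun_prop) (hM'.comp (by fun_prop))
    · exact ((PolyBounded.const 3).mul (hN'.polyBounded_size.mul hM'.polyBounded_size)).add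
        (.const 1)
    · rw [hfold, size_replicate_one]
      have h₁ := (h.length_le).trans (length_le_size _)
      have h₂ := length_le_size (List.replicate (M u.len) (1 : ℕ))
      rw [List.length_replicate] at h₂
      have : l₁.length * M u.len ≤ (toData (List.replicate (N u.len) (1 : ℕ))).size *
        (toData (List.replicate (M u.len) (1 : ℕ))).size := Nat.mul_le_mul h₁ h₂
      simp only
      omega
  exact .of_list (this.of_toData_eq fun u => by rw [hfold, List.length_replicate])

/-- An algorithm that runs several others cuts its coin tape at positions polynomial in `κ`, so it
must be able to compute these positions. -/
theorem EfficientParam.eval (Q : Polynomial ℕ) : EfficientParam fun k => Q.eval k := by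
  induction Q using Polynomial.induction_on' with
  | add p q hp hq => simpa only [Polynomial.eval_add] using hp.add hq
  | monomial n a =>
    have : ∀ n, EfficientParam fun k => k ^ n := by
      intro n
      induction n with
      | zero => simpa using EfficientParam.const 1
      | succ n ih => simpa only [pow_succ] using ih.mul .id
    simpa only [Polynomial.eval_monomial] using (EfficientParam.const a).mul (this n)

theorem EfficientParam.exists_le {N : ℕ → ℕ} (hN : EfficientParam N) :
    ∃ Q : Polynomial ℕ, ∀ k, N k ≤ Q.eval k := by
  obtain ⟨Q, hQ⟩ := PolyTime.polyBounded_size hN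
  refine ⟨Q.comp (3 * Polynomial.X + 1), fun k => ?_⟩
  have h := hQ ⟨k⟩
  have h₁ : (toData (⟨N k⟩ : Unary)).size = 3 * N k + 1 := size_replicate_one _
  have h₂ : (toData (⟨k⟩ : Unary)).size = 3 * k + 1 := size_replicate_one _
  simp only [h₁, h₂] at h
  simp only [Polynomial.eval_comp, Polynomial.eval_add, Polynomial.eval_mul, Polynomial.eval_X,
    Polynomial.eval_ofNat, Polynomial.eval_one]
  omega

end Lists

/-! ### Modular arithmetic in polynomial time -/

/-- Binary digits of `n`, the most significant one first. -/
def natBits (n : ℕ) : List ℕ := ((List.range n.size).map fun j => n / 2 ^ j % 2).reverse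

section

variable {α β : Type} [ToData α] [ToData β]

@[fun_prop]
-- No list of length `n.size` is available to fold over, so this is a bare `while` loop that halves
-- `n` until it reaches `0`. The resulting list of bits later serves as a counter for other folds.
theorem PolyTime.natBits {f : α → ℕ} (hf : PolyTime f) : PolyTime fun a => natBits (f a) := by
  suffices h : PolyTime VerFU.natBits from h.comp hf
  have hstep : PolyTime fun x : ℕ × List ℕ => (x.1 / 2, x.1 % 2 :: x.2) := by fun_prop
  obtain ⟨p, T, ⟨Q, hQ⟩, hr⟩ := hstep.exists_runs
  let acc : ℕ → ℕ → List ℕ := fun n k => ((List.range k).map fun j => n / 2 ^ j % 2).reverse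
  let st : ℕ → ℕ → ℕ × List ℕ := fun n k => (n / 2 ^ k, acc n k)
  have hsucc : ∀ n k, ((st n k).1 / 2, (st n k).1 % 2 :: (st n k).2) = st n (k + 1) := by
    intro n k
    simp only [st, acc, List.range_succ, List.map_append, List.reverse_append, Nat.div_div_eq_div_mul,
      pow_succ]
    rfl
  let E : ℕ → ℕ := fun n => 4 * (toData n).size + 3
  have hE : PolyBounded E := ((PolyBounded.const 4).mul .size).add (.const 3)
  have hst : ∀ n, ∀ k ≤ n.size, (toData (st n k)).size ≤ E n := by
    intro n k hk
    have h₁ : (n / 2 ^ k).size ≤ n.size := Nat.size_le_size (Nat.div_le_self _ _)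
    have h₂ := size_list_le (l := acc n k) (B := 2) fun b hb => by
      simp only [acc, List.mem_reverse, List.mem_map] at hb
      obtain ⟨j, -, rfl⟩ := hb
      rw [size_toData_nat]
      have := size_le_self (n / 2 ^ j % 2)
      have : (n / 2 ^ j % 2).size ≤ 1 := Nat.size_le.2 (by omega)
      omega
    have h₃ : (acc n k).length = k := by simp [acc]
    rw [h₃] at h₂
    simp only [size_toData_prod, size_toData_nat, E, st] at *
    omega
  let B : ℕ → ℕ := fun n => 2 * E n + Q.eval (E n)
  have hB : PolyBounded B := ((PolyBounded.const 2).mul hE).add (hE.eval Q)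
  have hinit : PolyTime fun n : ℕ => (n, ([] : List ℕ)) := by fun_prop
  obtain ⟨q, U, hU, hq⟩ := hinit.exists_runs
  have hloop : PolyTime fun n => st n n.size := by
    refine .of_runs (.seq q (.while (.instr .fst) p))
      (fun n => U n + (2 * B n * (toData n).size + B n + E n))
      (hU.add (((((PolyBounded.const 2).mul hB).mul .size).add hB).add hE)) fun n => ?_
    have hc : ∀ k ≤ n.size, ∃ t ≤ B n, Runs (.instr .fst) (toData (st n k))
        (toData (n / 2 ^ k)) t := fun k hk => by
      refine ⟨_, ?_, Runs.instr .fst (toData (st n k))⟩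
      have h₁ := hst n k hk
      have h₂ : (Instr.fst.eval (toData (st n k))).size ≤ (toData (st n k)).size := by
        change (toData (st n k).1).size ≤ _
        rw [size_toData_prod]
        omega
      simp only [B]
      omega
    obtain ⟨t, ht, hw⟩ := Runs.while_iterate (c := .instr .fst) (f := p)
      (fun k => toData (st n k)) (fun k => toData (n / 2 ^ k)) (B n) n.size (by
        intro k hk
        refine ⟨?_, hc k hk.le, ?_⟩
        · rw [toData_nat]
          intro h
          have h' : n / 2 ^ k = 0 := by injection h
          have := Nat.lt_size.1 hk
          have := (Nat.div_eq_zero_iff_lt (by positivity)).1 h'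
          omega
        · have hrun := hr (st n k)
          simp only [hsucc] at hrun
          refine ⟨_, ?_, hrun⟩
          have := (hQ (st n k)).trans (eval_natPoly_mono Q (hst n k hk.le))
          simp only [B]
          omega) (by
        have := hc n.size le_rfl
        rwa [Nat.div_eq_of_lt (Nat.lt_size_self n)] at this)
    refine ⟨U n + t, ?_, Runs.seq (hq n) (by simpa [st, acc] using hw)⟩
    have h₁ := hst n n.size le_rfl
    have h₂ : 2 * B n * n.size ≤ 2 * B n * (toData n).size :=
      Nat.mul_le_mul_left _ (by rw [size_toData_nat]; omega)
    omega
  exact hloop.snd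

/-- Product modulo `m`; bounded by `m` also for `m = 0`. -/
def mulMod (m a b : ℕ) : ℕ := bif decide (m = 0) then 0 else a * b % m

theorem mulMod_le (m a b : ℕ) : mulMod m a b ≤ m := by
  unfold mulMod
  by_cases h : m = 0
  · simp [h]
  · simpa [h] using (Nat.mod_lt _ (Nat.pos_of_ne_zero h)).le

theorem cast_mulMod (m a b : ℕ) [NeZero m] : (mulMod m a b : ZMod m) = a * b := by
  simp [mulMod, NeZero.ne m]

theorem mulMod_lt (m a b : ℕ) [NeZero m] : mulMod m a b < m := by
  simpa [mulMod, NeZero.ne m] using Nat.mod_lt _ (Nat.pos_of_ne_zero (NeZero.ne m))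

@[fun_prop]
theorem PolyTime.mulMod {m f g : α → ℕ} (hm : PolyTime m) (hf : PolyTime f) (hg : PolyTime g) :
    PolyTime fun a => mulMod (m a) (f a) (g a) := by
  unfold VerFU.mulMod
  fun_prop

theorem size_le_of_le {a b : ℕ} (h : a ≤ b) : (toData a).size ≤ (toData b).size := by
  rw [size_toData_nat, size_toData_nat]
  exact Nat.add_le_add_right (Nat.size_le_size h) 1

/-- Product of a list modulo `m`. -/
def prodMod (m : ℕ) (l : List ℕ) : ℕ := l.foldl (mulMod m) 1

theorem cast_foldl_mulMod (m : ℕ) [NeZero m] (l : List ℕ) (s : ℕ) :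
    ((l.foldl (mulMod m) s : ℕ) : ZMod m) = s * (l.map (Nat.cast : ℕ → ZMod m)).prod := by
  induction l generalizing s with
  | nil => simp
  | cons a l ih => rw [List.foldl_cons, ih, cast_mulMod, List.map_cons, List.prod_cons, mul_assoc]

theorem cast_prodMod (m : ℕ) [NeZero m] (l : List ℕ) :
    (prodMod m l : ZMod m) = (l.map (Nat.cast : ℕ → ZMod m)).prod := by
  rw [prodMod, cast_foldl_mulMod, Nat.cast_one, one_mul]

theorem foldl_le {β : Type} {B : ℕ} {step : ℕ → β → ℕ} (h : ∀ s b, step s b ≤ B) (l : List β)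
    {s : ℕ} (hs : s ≤ B) : l.foldl step s ≤ B := by
  induction l generalizing s with
  | nil => exact hs
  | cons b l ih => exact ih (h _ _)

@[fun_prop]
theorem PolyTime.prodMod {m : α → ℕ} {l : α → List ℕ} (hm : PolyTime m) (hl : PolyTime l) :
    PolyTime fun a => prodMod (m a) (l a) := by
  unfold VerFU.prodMod
  -- The bound is `m + 1` because the accumulator starts at `1` and `m` may be `0`.
  have hm' : PolyTime fun a => m a + 1 := by fun_prop
  refine .foldl (step := fun a s b => VerFU.mulMod (m a) s b) ?_ (.const _) hl
    ⟨_, hm'.polyBounded_size, fun a l₁ _ => ?_⟩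
  · have : PolyTime fun x : α × ℕ × ℕ => m x.1 := hm.comp (by fun_prop)
    fun_prop
  · exact size_le_of_le (foldl_le (fun s b => (mulMod_le _ _ _).trans (by omega)) l₁ (by omega))

/-- Power modulo `m`. -/
def powMod (m g e : ℕ) : ℕ :=
  (natBits e).foldl (fun s b => mulMod m (mulMod m s s) (bif decide (b = 0) then 1 else g)) 1

theorem cast_powMod (m g e : ℕ) [NeZero m] : (powMod m g e : ZMod m) = (g : ZMod m) ^ e := by
  -- Square and multiply: reading the lowest `k` bits of `e`, highest first, squares the accumulator
  -- `k` times and contributes the exponent `e % 2 ^ k`.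
  have key : ∀ (k s : ℕ), ((((List.range k).map fun j => e / 2 ^ j % 2).reverse.foldl
      (fun s b => mulMod m (mulMod m s s) (bif decide (b = 0) then 1 else g)) s : ℕ) : ZMod m)
      = (s : ZMod m) ^ 2 ^ k * (g : ZMod m) ^ (e % 2 ^ k) := by
    intro k
    induction k with
    | zero => intro s; simp [Nat.mod_one]
    | succ k ih =>
      intro s
      rw [List.range_succ, List.map_append, List.reverse_append]
      simp only [List.map_cons, List.map_nil, List.reverse_singleton, List.singleton_append,
        List.foldl_cons]
      rw [ih, cast_mulMod, cast_mulMod, Nat.mod_pow_succ, pow_add _ (e % 2 ^ k), pow_mul' _ (2 ^ k)]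
      have : ((bif decide (e / 2 ^ k % 2 = 0) then 1 else g : ℕ) : ZMod m)
          = (g : ZMod m) ^ (e / 2 ^ k % 2) := by
        rcases Nat.mod_two_eq_zero_or_one (e / 2 ^ k) with h | h <;> simp [h]
      rw [this]
      ring
  rw [powMod, natBits, key, Nat.cast_one, one_pow, one_mul, Nat.mod_eq_of_lt (Nat.lt_size_self e)]

@[fun_prop]
theorem PolyTime.powMod {m g e : α → ℕ} (hm : PolyTime m) (hg : PolyTime g) (he : PolyTime e) :
    PolyTime fun a => powMod (m a) (g a) (e a) := by
  unfold VerFU.powMod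
  have hm' : PolyTime fun a => m a + 1 := by fun_prop
  refine .foldl (step := fun a s b => VerFU.mulMod (m a) (VerFU.mulMod (m a) s s)
    (bif decide (b = 0) then 1 else g a)) ?_ (.const _) he.natBits
    ⟨_, hm'.polyBounded_size, fun a l₁ _ => ?_⟩
  · have : PolyTime fun x : α × ℕ × ℕ => m x.1 := hm.comp (by fun_prop)
    have : PolyTime fun x : α × ℕ × ℕ => g x.1 := hg.comp (by fun_prop)
    fun_prop
  · exact size_le_of_le (foldl_le (fun s b => (mulMod_le _ _ _).trans (by omega)) l₁ (by omega))

/-- One step of the extended Euclidean algorithm modulo `m`, on `(r₀, r₁, s₀, s₁)`. -/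
def euclidStep (m : ℕ) (x : ℕ × ℕ × ℕ × ℕ) : ℕ × ℕ × ℕ × ℕ :=
  bif decide (x.2.1 = 0) then x
  else (x.2.1, x.1 % x.2.1, x.2.2.2,
    mulMod m 1 (x.2.2.1 + (m - mulMod m (x.1 / x.2.1) x.2.2.2)))

/-- Inverse modulo `m` by the extended Euclidean algorithm. -/
def invMod (m x : ℕ) : ℕ :=
  ((natBits (m * m)).foldl (fun s _ => euclidStep m s) (m, x % m, 0, 1)).2.2.1

theorem euclidStep_bounds {m B : ℕ} (hm : m ≤ B) {x : ℕ × ℕ × ℕ × ℕ}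
    (h : x.1 ≤ B ∧ x.2.1 ≤ B ∧ x.2.2.1 ≤ B ∧ x.2.2.2 ≤ B) :
    (euclidStep m x).1 ≤ B ∧ (euclidStep m x).2.1 ≤ B ∧ (euclidStep m x).2.2.1 ≤ B ∧
      (euclidStep m x).2.2.2 ≤ B := by
  unfold euclidStep
  by_cases h0 : x.2.1 = 0
  · simpa [h0] using h
  · simp only [h0, decide_false, Bool.cond_false]
    exact ⟨h.2.1, (Nat.mod_lt _ (Nat.pos_of_ne_zero h0)).le.trans h.2.1, h.2.2.2,
      (mulMod_le _ _ _).trans hm⟩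

@[fun_prop]
theorem PolyTime.invMod {m x : α → ℕ} (hm : PolyTime m) (hx : PolyTime x) :
    PolyTime fun a => invMod (m a) (x a) := by
  unfold VerFU.invMod
  have hb : PolyTime fun a => m a + x a + 1 := by fun_prop
  refine PolyTime.fst (PolyTime.snd (PolyTime.snd ?_))
  refine .foldl (step := fun a s _ => euclidStep (m a) s) ?_ (by fun_prop) (by fun_prop)
    ⟨fun a => 4 * (toData (m a + x a + 1)).size + 3,
      ((PolyBounded.const 4).mul hb.polyBounded_size).add (.const 3), fun a l₁ _ => ?_⟩
  · have : PolyTime fun x : α × (ℕ × ℕ × ℕ × ℕ) × ℕ => m x.1 := hm.comp (by fun_prop)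
    unfold euclidStep
    fun_prop
  · have key : ∀ (l : List ℕ) (s : ℕ × ℕ × ℕ × ℕ), (s.1 ≤ m a + x a + 1 ∧ s.2.1 ≤ m a + x a + 1 ∧
        s.2.2.1 ≤ m a + x a + 1 ∧ s.2.2.2 ≤ m a + x a + 1) →
        (toData (l.foldl (fun s _ => euclidStep (m a) s) s)).size
          ≤ 4 * (toData (m a + x a + 1)).size + 3 := by
      intro l
      induction l with
      | nil =>
        rintro s ⟨h₁, h₂, h₃, h₄⟩
        have := size_le_of_le h₁
        have := size_le_of_le h₂
        have := size_le_of_le h₃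
        have := size_le_of_le h₄
        simp only [List.foldl_nil, size_toData_prod]
        omega
      | cons b l ih => exact fun s hs => ih _ (euclidStep_bounds (by omega) hs)
    refine key l₁ _ ⟨by simp only; omega, ?_, by simp, by simp⟩
    have := Nat.mod_le (x a) (m a)
    simp only
    omega

/-- Along the extended Euclidean algorithm `rᵢ = sᵢ x` modulo `m` and `gcd(r₀, r₁) = 1`. The product
`r₀ r₁` starts at no more than `m²` and at least halves in each step, so after `(m * m).size` steps
it is `0`. Then `r₁ = 0` and `r₀ = 1`, and `s₀` is the inverse. Steps after termination change
nothing. -/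
theorem invMod_spec (m x : ℕ) [NeZero m] (hx : x.Coprime m) :
    (invMod m x : ZMod m) * x = 1 := by
  let Inv : ℕ → ℕ × ℕ × ℕ × ℕ → Prop := fun k s =>
    s.2.1 < s.1 ∧ s.1 * s.2.1 * 2 ^ k ≤ m * m ∧ Nat.gcd s.1 s.2.1 = 1 ∧
      (s.1 : ZMod m) = s.2.2.1 * x ∧ (s.2.1 : ZMod m) = s.2.2.2 * x
  have hm : 0 < m := Nat.pos_of_ne_zero (NeZero.ne m)
  have h0 : Inv 0 (m, x % m, 0, 1) := by
    refine ⟨Nat.mod_lt _ hm, ?_, ?_, by simp, by simp⟩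
    · simpa using Nat.mul_le_mul_left m (Nat.mod_lt x hm).le
    · simp only
      rw [Nat.gcd_comm, ← Nat.gcd_rec]
      exact hx.symm
  have hstep : ∀ k s, Inv k s → Inv (k + 1) (euclidStep m s) := by
    rintro k ⟨r₀, r₁, s₀, s₁⟩ ⟨h₁, h₂, h₃, h₄, h₅⟩
    simp only at h₁ h₂ h₃ h₄ h₅
    by_cases hr : r₁ = 0
    · subst hr
      simp only [euclidStep, decide_true, Bool.cond_true]
      exact ⟨h₁, by simp, h₃, h₄, h₅⟩
    · have hr' := Nat.pos_of_ne_zero hr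
      simp only [euclidStep, hr, decide_false, Bool.cond_false]
      refine ⟨Nat.mod_lt _ hr', ?_, ?_, h₅, ?_⟩
      · refine le_trans ?_ h₂
        have hq := Nat.div_add_mod r₀ r₁
        have hq1 : 1 ≤ r₀ / r₁ := (Nat.one_le_div_iff hr').2 h₁.le
        have hlt := Nat.mod_lt r₀ hr'
        -- As `r₁ < r₀`, the quotient is at least `1`, so `r₀ ≥ r₁ + r₀ % r₁`, and the remainder is
        -- smaller than `r₁`.
        have h2 : 2 * (r₀ % r₁) ≤ r₀ := by nlinarith
        calc r₁ * (r₀ % r₁) * 2 ^ (k + 1) = (r₁ * (2 * (r₀ % r₁))) * 2 ^ k := by ring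
          _ ≤ (r₁ * r₀) * 2 ^ k := by gcongr
          _ = r₀ * r₁ * 2 ^ k := by ring
      · simp only
        rw [Nat.gcd_comm, ← Nat.gcd_rec, Nat.gcd_comm]
        exact h₃
      · simp only
        rw [cast_mulMod, Nat.cast_add, Nat.cast_sub (mulMod_le _ _ _), cast_mulMod]
        have hq : ((r₁ * (r₀ / r₁) + r₀ % r₁ : ℕ) : ZMod m) = (r₀ : ZMod m) := by
          rw [Nat.div_add_mod]
        push_cast at hq ⊢
        rw [ZMod.natCast_self]
        linear_combination hq + h₄ - (r₀ / r₁ : ℕ) * h₅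
  have hfold : ∀ l : List ℕ, Inv l.length
      (l.foldl (fun s _ => euclidStep m s) (m, x % m, 0, 1)) := by
    intro l
    rw [foldl_count l (euclidStep m)]
    induction l.length with
    | zero => exact h0
    | succ k ih => rw [Function.iterate_succ_apply']; exact hstep _ _ ih
  have hfin := hfold (natBits (m * m))
  rw [show (natBits (m * m)).length = (m * m).size by simp [natBits]] at hfin
  unfold invMod
  generalize (natBits (m * m)).foldl (fun s _ => euclidStep m s) (m, x % m, 0, 1) = s at hfin
  obtain ⟨r₀, r₁, s₀, s₁⟩ := s
  obtain ⟨h₁, h₂, h₃, h₄, -⟩ := hfin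
  simp only at h₁ h₂ h₃ h₄ ⊢
  have hr : r₁ = 0 := by
    by_contra hr
    have hsz := Nat.lt_size_self (m * m)
    have : 1 * 2 ^ (m * m).size ≤ r₀ * r₁ * 2 ^ (m * m).size :=
      Nat.mul_le_mul_right _ (Nat.one_le_iff_ne_zero.2 (Nat.mul_ne_zero (by omega) hr))
    omega
  rw [hr, Nat.gcd_zero_right] at h₃
  rw [← h₄, h₃, Nat.cast_one]

theorem invMod_lt (m x : ℕ) [NeZero m] (hm : 1 < m) : invMod m x < m := by
  have key : ∀ (l : List ℕ) (s : ℕ × ℕ × ℕ × ℕ), s.2.2.1 < m → s.2.2.2 < m →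
      (l.foldl (fun s _ => euclidStep m s) s).2.2.1 < m := by
    intro l
    induction l with
    | nil => exact fun s h _ => h
    | cons b l ih =>
      intro s h₁ h₂
      rw [List.foldl_cons]
      by_cases h : s.2.1 = 0
      · exact ih _ (by simpa [euclidStep, h] using h₁) (by simpa [euclidStep, h] using h₂)
      · exact ih _ (by simpa [euclidStep, h] using h₂) (by simpa [euclidStep, h] using mulMod_lt _ _ _)
  exact key _ _ (by simpa using by omega) hm

/-- The digits of `ρ` in base `n`, the least significant one first, as many as `l` has entries. -/
def digitList {β : Type} (n ρ : ℕ) (l : List β) : List ℕ :=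
  (l.foldl (fun (s : ℕ × List ℕ) _ => (s.1 / n, s.1 % n :: s.2)) (ρ, [])).2.reverse

theorem digitList_fold {β : Type} (n ρ : ℕ) (l : List β) :
    l.foldl (fun (s : ℕ × List ℕ) _ => (s.1 / n, s.1 % n :: s.2)) (ρ, [])
      = (ρ / n ^ l.length, ((List.range l.length).map fun j => ρ / n ^ j % n).reverse) := by
  rw [foldl_count l (fun s : ℕ × List ℕ => (s.1 / n, s.1 % n :: s.2))]
  induction l.length with
  | zero => simp
  | succ k ih =>
    rw [Function.iterate_succ_apply', ih, List.range_succ]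
    simp [Nat.div_div_eq_div_mul, pow_succ]

theorem digitList_eq {β : Type} (n ρ : ℕ) (l : List β) :
    digitList n ρ l = (List.range l.length).map fun j => ρ / n ^ j % n := by
  rw [digitList, digitList_fold, List.reverse_reverse]

@[fun_prop]
theorem PolyTime.digitList {n ρ : α → ℕ} {l : α → List β} (hn : PolyTime n) (hρ : PolyTime ρ)
    (hl : PolyTime l) : PolyTime fun a => digitList (n a) (ρ a) (l a) := by
  unfold VerFU.digitList
  refine PolyTime.reverse (PolyTime.snd ?_)
  refine .foldl (step := fun a (s : ℕ × List ℕ) _ => (s.1 / n a, s.1 % n a :: s.2)) ?_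
    (by fun_prop) hl ⟨fun a => (toData (ρ a)).size + ((toData (l a)).size *
      ((toData (ρ a)).size + 1) + 1) + 1, ?_, fun a l₁ h => ?_⟩
  · have : PolyTime fun x : α × (ℕ × List ℕ) × β => n x.1 := hn.comp (by fun_prop)
    fun_prop
  · have h := hρ.polyBounded_size
    exact (h.add ((hl.polyBounded_size.mul (h.add (.const 1))).add (.const 1))).add (.const 1)
  · rw [digitList_fold, size_toData_prod]
    have h₁ := size_le_of_le (Nat.div_le_self (ρ a) (n a ^ l₁.length))
    have h₂ := size_list_le (l := ((List.range l₁.length).map fun j => ρ a / n a ^ j % n a).reverse)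
      (B := (toData (ρ a)).size) fun b hb => by
        simp only [List.mem_reverse, List.mem_map] at hb
        obtain ⟨j, -, rfl⟩ := hb
        exact size_le_of_le ((Nat.mod_le _ _).trans (Nat.div_le_self _ _))
    rw [List.length_reverse, List.length_map, List.length_range] at h₂
    have h₃ := Nat.mul_le_mul_right ((toData (ρ a)).size + 1)
      ((h.length_le).trans (length_le_size (l a)))
    simp only at *
    omega

end

/-! ### The round and the claims as computations on natural numbers -/

section

variable {α β : Type} [ToData α] [ToData β]

@[fun_prop]
theorem PolyTime.sq {f : α → ℕ} (hf : PolyTime f) : PolyTime fun a => f a ^ 2 := by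
  simp only [pow_two]
  fun_prop

@[fun_prop]
theorem PolyTime.isSome {o : α → Option β} (ho : PolyTime o) : PolyTime fun a => (o a).isSome :=
  (ho.test (PolyTime.const true) (PolyTime.const false) (fun a => (o a).isSome) fun a => by
    cases o a <;> simp [toData]).of_toData_eq fun a => by cases o a <;> rfl

@[fun_prop]
theorem PolyTime.option_getD {o : α → Option β} {x : α → β} (ho : PolyTime o) (hx : PolyTime x) :
    PolyTime fun a => (o a).getD (x a) := by
  have hsnd : PolyTime fun o : Option β => Instr.snd.eval (toData o) := by
    refine .of_instr .snd (fun _ => rfl) (PolyBounded.size.mono fun o => ?_)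
    cases o with
    | none => exact le_rfl
    | some b =>
      change (toData b).size ≤ (toData 0).size + (toData b).size + 1
      omega
  have hx' : PolyTime fun a => toData (x a) := hx.of_toData_eq fun _ => rfl
  exact (ho.isSome.cond (hsnd.comp ho) hx').of_toData_eq fun a => by cases o a <;> rfl

end

/-- Plaintext update of device `i` in coordinate `k`, as a natural number. -/
def natUpdate (n : ℕ) (t : Unary) (f : List Bool) (h : Histories) (i k : ℕ) : ℕ :=
  (bif f.getD i true then ((h.getD i []).getD (t.len - 1) []).getD k 0
    else ((List.range t.len).map fun s => ((h.getD i []).getD s []).getD k 0).sum) % n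

/-- Encryption of `c` with randomness `r`, as a natural number. -/
def natEnc (n g c r : ℕ) : ℕ := mulMod (n ^ 2) (powMod (n ^ 2) g c) (powMod (n ^ 2) r n)

/-- The uploads when the encryption of coordinate `k` of device `i` uses the entry `i * d + k` of
the list `rs` of random numbers. -/
def natUploads (n g : ℕ) (N d t : Unary) (f : List Bool) (h : Histories) (rs : List ℕ) :
    List (List ℕ) :=
  (List.range N.len).map fun i => (List.range d.len).map fun k =>
    natEnc n g (natUpdate n t f h i k) (rs.getD (i * d.len + k) 0)

/-- The encrypted result computed from the uploads. -/
def natAggregate (n : ℕ) (N d : Unary) (f : List Bool) (x : List (List ℕ)) : List ℕ :=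
  (List.range d.len).map fun k => prodMod (n ^ 2) ((List.range N.len).map fun i =>
    bif f.getD i true then (x.getD i []).getD k 0 else invMod (n ^ 2) ((x.getD i []).getD k 0))

/-- The view of the round computed from a list of random numbers. -/
def natView (n g : ℕ) (N d t : Unary) (f : List Bool) (h : Histories) (rs : List ℕ) : View :=
  ((List.range N.len).map fun i => f.getD i true, natUploads n g N d t f h rs,
    natAggregate n N d f (natUploads n g N d t f h rs))

/-- Test of a claim. -/
def natCorrect (n : ℕ) (N d t : Unary) (h : Histories) (c : Claim) : Bool :=
  decide (c.1 < N.len) &&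
    bif c.2.1.isSome then
      decide (1 ≤ c.2.1.getD 0) && (decide (c.2.1.getD 0 ≤ t.len) &&
        (List.range d.len).all fun k => decide (c.2.2.getD k 0 % n
          = ((h.getD c.1 []).getD (c.2.1.getD 0 - 1) []).getD k 0 % n))
    else (List.range d.len).all fun k => decide (c.2.2.getD k 0 % n
      = ((List.range t.len).map fun s => ((h.getD c.1 []).getD s []).getD k 0).sum % n)

section

variable {α : Type} [ToData α]

@[fun_prop]
theorem PolyTime.natUpdate {n i k : α → ℕ} {t : α → Unary} {f : α → List Bool}
    {h : α → Histories} (hn : PolyTime n) (ht : PolyTime t) (hf : PolyTime f) (hh : PolyTime h)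
    (hi : PolyTime i) (hk : PolyTime k) :
    PolyTime fun a => natUpdate (n a) (t a) (f a) (h a) (i a) (k a) := by
  unfold VerFU.natUpdate
  fun_prop

@[fun_prop]
theorem PolyTime.natEnc {n g c r : α → ℕ} (hn : PolyTime n) (hg : PolyTime g) (hc : PolyTime c)
    (hr : PolyTime r) : PolyTime fun a => natEnc (n a) (g a) (c a) (r a) := by
  unfold VerFU.natEnc
  fun_prop

@[fun_prop]
theorem PolyTime.natUploads {n g : α → ℕ} {N d t : α → Unary} {f : α → List Bool}
    {h : α → Histories} {rs : α → List ℕ} (hn : PolyTime n) (hg : PolyTime g) (hN : PolyTime N)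
    (hd : PolyTime d) (ht : PolyTime t) (hf : PolyTime f) (hh : PolyTime h) (hr : PolyTime rs) :
    PolyTime fun a => natUploads (n a) (g a) (N a) (d a) (t a) (f a) (h a) (rs a) := by
  unfold VerFU.natUploads
  fun_prop

@[fun_prop]
theorem PolyTime.natAggregate {n : α → ℕ} {N d : α → Unary} {f : α → List Bool}
    {x : α → List (List ℕ)} (hn : PolyTime n) (hN : PolyTime N) (hd : PolyTime d)
    (hf : PolyTime f) (hx : PolyTime x) :
    PolyTime fun a => natAggregate (n a) (N a) (d a) (f a) (x a) := by
  unfold VerFU.natAggregate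
  fun_prop

@[fun_prop]
theorem PolyTime.natView {n g : α → ℕ} {N d t : α → Unary} {f : α → List Bool}
    {h : α → Histories} {rs : α → List ℕ} (hn : PolyTime n) (hg : PolyTime g) (hN : PolyTime N)
    (hd : PolyTime d) (ht : PolyTime t) (hf : PolyTime f) (hh : PolyTime h) (hr : PolyTime rs) :
    PolyTime fun a => natView (n a) (g a) (N a) (d a) (t a) (f a) (h a) (rs a) := by
  unfold VerFU.natView
  fun_prop

@[fun_prop]
theorem PolyTime.natCorrect {n : α → ℕ} {N d t : α → Unary} {h : α → Histories} {c : α → Claim}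
    (hn : PolyTime n) (hN : PolyTime N) (hd : PolyTime d) (ht : PolyTime t) (hh : PolyTime h)
    (hc : PolyTime c) : PolyTime fun a => natCorrect (n a) (N a) (d a) (t a) (h a) (c a) := by
  unfold VerFU.natCorrect
  fun_prop

end

/-! ### Agreement with the definitions over `ZMod` -/

theorem map_range_eq_ofFn {β : Type} (N : ℕ) (F : ℕ → β) :
    (List.range N).map F = List.ofFn fun i : Fin N => F i := by
  apply List.ext_getElem <;> simp

theorem getD_ofFn {β : Type} {N : ℕ} (F : Fin N → β) (i : Fin N) (x : β) :
    (List.ofFn F).getD i x = F i := by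
  rw [List.getD_eq_getElem _ _ (by simp), List.getElem_ofFn]

/-- Rounds are numbered from `1`, list positions from `0`. -/
theorem sum_Icc_one_pred {M : Type} [AddCommMonoid M] (F : ℕ → M) (t : ℕ) :
    ∑ s ∈ Finset.Icc 1 t, F (s - 1) = ((List.range t).map F).sum := by
  induction t with
  | zero => simp
  | succ t ih => rw [Finset.sum_Icc_succ_top (by omega), ih, List.range_succ]; simp

variable (P : PrimePair)

theorem contribution_apply (d t : ℕ) (h : Histories) (i : ℕ) (k : Fin d) :
    contribution P d h i t k
      = ((((List.range t).map fun s => ((h.getD i []).getD s []).getD k 0).sum : ℕ) : P.Plain) := by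
  rw [contribution, Finset.sum_apply]
  simp only [gradient]
  rw [sum_Icc_one_pred (fun s => ((((h.getD i []).getD s []).getD k 0 : ℕ) : P.Plain)),
    Nat.cast_list_sum, List.map_map]
  rfl

theorem natUpdate_eq (d t : ℕ) (f : List Bool) (h : Histories) (i : ℕ) (k : Fin d) :
    natUpdate P.n ⟨t⟩ f h i k = (update P d t f h i k).val := by
  unfold natUpdate update status
  cases f.getD i true
  · simp only [cond_false, Bool.false_eq_true, if_false]
    rw [contribution_apply, ZMod.val_natCast]
  · simp only [cond_true, if_true]
    rw [gradient, ZMod.val_natCast]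

instance : NeZero (P.n ^ 2) := ⟨pow_ne_zero 2 (NeZero.ne P.n)⟩

theorem PrimePair.one_lt_sq : 1 < P.n ^ 2 := Nat.one_lt_pow two_ne_zero P.one_lt_n

/-- Turns an identity in `ℤ/n²` into one between machine numbers, as soon as the computed number is
known to be reduced. -/
theorem PrimePair.repr_eq {c : P.Cipher} {m : ℕ} (hm : m < P.n ^ 2)
    (h : (m : ZMod (P.n ^ 2)) = c) : P.repr c = m := by
  rw [repr, ← h, ZMod.val_natCast, Nat.mod_eq_of_lt hm]

theorem PrimePair.cast_repr (c : P.Cipher) : (P.repr c : ZMod (P.n ^ 2)) = c :=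
  ZMod.natCast_zmod_val _

theorem natEnc_eq (g : P.Cipher) (c : P.Plain) (r : (ZMod P.n)ˣ) :
    natEnc P.n (P.repr g) c.val (r : ZMod P.n).val = P.repr (P.enc g c r) := by
  symm
  apply P.repr_eq (mulMod_lt _ _ _)
  rw [cast_mulMod, cast_powMod, cast_powMod, P.cast_repr, PrimePair.enc, PrimePair.lift]
  push_cast
  simp

theorem invMod_repr (c : P.Cipher) : invMod (P.n ^ 2) (P.repr c) = P.repr c⁻¹ := by
  symm
  apply P.repr_eq (invMod_lt _ _ P.one_lt_sq)
  have h := invMod_spec (P.n ^ 2) (P.repr c) (ZMod.val_coe_unit_coprime c)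
  rw [P.cast_repr] at h
  rw [← Units.mul_left_inj c, h, Units.inv_mul]

theorem prodMod_lt {m : ℕ} [NeZero m] (hm : 1 < m) (l : List ℕ) : prodMod m l < m := by
  have := foldl_le (B := m - 1) (step := mulMod m)
    (fun s b => Nat.le_sub_one_of_lt (mulMod_lt m s b)) l (s := 1) (by omega)
  rw [prodMod]
  omega

theorem natView_eq (g : P.Cipher) (N d t : ℕ) (f : List Bool) (h : Histories)
    (r : Fin N → Fin d → (ZMod P.n)ˣ) (rs : List ℕ)
    (hrs : ∀ i k, rs.getD ((i : Fin N) * d + (k : Fin d)) 0 = (r i k : ZMod P.n).val) :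
    natView P.n (P.repr g) ⟨N⟩ ⟨d⟩ ⟨t⟩ f h rs = view P g N d t f h r := by
  have hx : natUploads P.n (P.repr g) ⟨N⟩ ⟨d⟩ ⟨t⟩ f h rs
      = List.ofFn fun i => List.ofFn fun k => P.repr (uploads P g N d t f h r i k) := by
    simp only [natUploads, map_range_eq_ofFn, uploads, natUpdate_eq, hrs, natEnc_eq]
  unfold natView view
  rw [hx]
  refine Prod.ext ?_ (Prod.ext rfl ?_)
  · simp only [map_range_eq_ofFn, statusList, status]
  · simp only [natAggregate, map_range_eq_ofFn]
    congr 1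
    funext k
    symm
    apply P.repr_eq (prodMod_lt P.one_lt_sq _)
    rw [cast_prodMod, aggregate, List.map_ofFn, List.prod_ofFn, Units.coe_prod]
    refine Finset.prod_congr rfl fun i _ => ?_
    have hik : ((List.ofFn fun i => List.ofFn fun k =>
        P.repr (uploads P g N d t f h r i k)).getD i []).getD k 0
        = P.repr (uploads P g N d t f h r i k) := by
      rw [getD_ofFn, getD_ofFn]
    simp only [Function.comp_apply, hik, invMod_repr]
    rw [show f.getD i true = status f i from rfl]
    by_cases hf : status f i = true
    · rw [if_pos hf, hf, cond_true, P.cast_repr]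
    · rw [if_neg hf, Bool.eq_false_of_not_eq_true hf, cond_false, P.cast_repr]

/-- A distinguisher that plays the recovery experiment has to judge the claim itself, whereas
`Claim.correct` is decided classically. -/
theorem natCorrect_eq (N d t : ℕ) (h : Histories) (c : Claim) :
    natCorrect P.n ⟨N⟩ ⟨d⟩ ⟨t⟩ h c = Claim.correct P N d t h c := by
  have hvec : ∀ (F : ℕ → ℕ) (G : Fin d → P.Plain), (∀ k, G k = (F k : ℕ)) →
      ((List.range d).all (fun k => decide (c.2.2.getD k 0 % P.n = F k % P.n)) = true
        ↔ (fun k : Fin d => ((c.2.2.getD k 0 : ℕ) : P.Plain)) = G) := by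
    intro F G hG
    rw [List.all_eq_true, funext_iff]
    simp only [List.mem_range, decide_eq_true_eq, hG, ZMod.natCast_eq_natCast_iff']
    exact ⟨fun H k => H k k.2, fun H k hk => H ⟨k, hk⟩⟩
  obtain ⟨i, s, u⟩ := c
  rw [Bool.eq_iff_iff]
  cases s with
  | none =>
    have := hvec (fun k => ((List.range t).map fun s =>
      ((h.getD i []).getD s []).getD k 0).sum) _ (contribution_apply P d t h i)
    simp only at this
    simp only [natCorrect, Claim.correct, Option.isSome_none, cond_false, Bool.and_eq_true,
      decide_eq_true_eq, this]
  | some s =>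
    have := hvec (fun k => ((h.getD i []).getD (s - 1) []).getD k 0) (gradient P d h i s)
      fun k => rfl
    simp only at this
    simp only [natCorrect, Claim.correct, Option.isSome_some, cond_true, Bool.and_eq_true,
      decide_eq_true_eq, Option.getD_some, this]

/-! ### Structure of the Paillier group -/

namespace PrimePair

variable (P : PrimePair)

/-- Reduction modulo `n`. -/
def red : P.Cipher →* (ZMod P.n)ˣ :=
  Units.map (ZMod.castHom (Dvd.intro_left (P.n ^ 1) (pow_succ P.n 1).symm) (ZMod P.n)).toMonoidHom

/-- If `x = y + kn`, every term of the binomial expansion of `x^n` other than `y^n` is divisible by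
`n²`. -/
theorem pow_n_eq_of_red_eq {x y : P.Cipher} (h : P.red x = P.red y) : x ^ P.n = y ^ P.n := by
  have h' : ((P.repr x : ℕ) : ZMod P.n) = (P.repr y : ℕ) := by
    have := congrArg Units.val h
    simpa [red, ZMod.castHom_apply, repr] using this
  have hdvd : ((P.n : ℕ) : ℤ) ∣ (P.repr x : ℤ) - P.repr y := by
    rw [← ZMod.intCast_zmod_eq_zero_iff_dvd]
    push_cast
    rw [h', sub_self]
  have key := dvd_sub_pow_of_dvd_sub hdvd 1
  rw [pow_one] at key
  have h2 : (((P.repr x : ℤ) ^ P.n - (P.repr y : ℤ) ^ P.n : ℤ) : ZMod (P.n ^ 2)) = 0 := by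
    rw [ZMod.intCast_zmod_eq_zero_iff_dvd]
    exact_mod_cast key
  push_cast at h2
  rw [P.cast_repr, P.cast_repr, sub_eq_zero] at h2
  exact Units.ext (by push_cast; exact h2)

theorem red_lift (r : (ZMod P.n)ˣ) : P.red (P.lift r) = r := by
  apply Units.ext
  simp [red, lift]

/-- Encryption under a generator that is an `n`-th power. -/
theorem enc_pow_n (z : P.Cipher) (c : P.Plain) (r : (ZMod P.n)ˣ) :
    P.enc (z ^ P.n) c r = P.lift (P.red z ^ c.val * r) ^ P.n := by
  rw [enc, ← pow_mul, mul_comm P.n, pow_mul, ← mul_pow]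
  apply P.pow_n_eq_of_red_eq
  rw [map_mul, map_pow, red_lift, red_lift]

/-- Fermat modulo `p` and modulo `q`, since `p - 1` and `q - 1` divide `λ`; the two congruences
combine as `p` and `q` are coprime. -/
theorem pow_lam_eq_one (u : (ZMod P.n)ˣ) : u ^ P.lam = 1 := by
  have hco : Nat.Coprime P.p P.q := (Nat.coprime_primes P.prime_p P.prime_q).2 P.ne
  have := Fact.mk P.prime_p
  have := Fact.mk P.prime_q
  have h : ∀ {ℓ : ℕ} [Fact ℓ.Prime], ℓ ∣ P.n → ℓ - 1 ∣ P.lam →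
      (((u : ZMod P.n).val ^ P.lam : ℕ) : ZMod ℓ) = 1 := by
    intro ℓ _ hd hl
    have hc : Nat.Coprime (u : ZMod P.n).val ℓ :=
      (ZMod.val_coe_unit_coprime u).coprime_dvd_right hd
    obtain ⟨m, hm⟩ := hl
    have hne : (((u : ZMod P.n).val : ℕ) : ZMod ℓ) ≠ 0 := by
      have := (ZMod.isUnit_iff_coprime (u : ZMod P.n).val ℓ).2 hc
      exact this.ne_zero
    rw [Nat.cast_pow, hm, pow_mul, ZMod.pow_card_sub_one_eq_one hne, one_pow]
  have hp := h (ℓ := P.p) (Dvd.intro _ rfl) (Nat.dvd_lcm_left _ _)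
  have hq := h (ℓ := P.q) (Dvd.intro_left _ rfl) (Nat.dvd_lcm_right _ _)
  have hp' : (u : ZMod P.n).val ^ P.lam ≡ 1 [MOD P.p] :=
    (ZMod.natCast_eq_natCast_iff _ _ _).1 (by rw [hp, Nat.cast_one])
  have hq' : (u : ZMod P.n).val ^ P.lam ≡ 1 [MOD P.q] :=
    (ZMod.natCast_eq_natCast_iff _ _ _).1 (by rw [hq, Nat.cast_one])
  have := (Nat.modEq_and_modEq_iff_modEq_mul hco).1 ⟨hp', hq'⟩
  have := (ZMod.natCast_eq_natCast_iff _ _ P.n).2 this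
  apply Units.ext
  simpa using this

/-- `L(g^λ mod n²)` modulo `n`. -/
def logLam (g : P.Cipher) : ZMod P.n := ((P.L (P.repr (g ^ P.lam)) : ℕ) : ZMod P.n)

/-- Since `g^λ` is `1` modulo `n`, the division in `L` is exact. -/
theorem repr_pow_lam (g : P.Cipher) :
    P.repr (g ^ P.lam) = 1 + P.n * P.L (P.repr (g ^ P.lam)) := by
  have h1 : P.red (g ^ P.lam) = 1 := by rw [map_pow, pow_lam_eq_one]
  have h2 : ((P.repr (g ^ P.lam) : ℕ) : ZMod P.n) = 1 := by
    have := congrArg Units.val h1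
    simpa only [red, repr, Units.coe_map, Units.val_one, RingHom.toMonoidHom_eq_coe,
      MonoidHom.coe_coe, ZMod.castHom_apply, ZMod.natCast_val] using this
  have h3 : P.repr (g ^ P.lam) ≡ 1 [MOD P.n] :=
    (ZMod.natCast_eq_natCast_iff _ _ _).1 (by rw [h2, Nat.cast_one])
  have hpos : 1 ≤ P.repr (g ^ P.lam) := by
    by_contra h0
    have h0' : P.repr (g ^ P.lam) = 0 := by omega
    rw [h0', Nat.cast_zero] at h2
    have : Fact (1 < P.n) := ⟨P.one_lt_n⟩
    exact zero_ne_one h2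
  have hd : P.n ∣ P.repr (g ^ P.lam) - 1 := (Nat.modEq_iff_dvd' hpos).1 h3.symm
  rw [L, Nat.mul_div_cancel' hd]
  omega

theorem n_mul_n_eq_zero : (P.n : ZMod (P.n ^ 2)) * P.n = 0 := by
  rw [← Nat.cast_mul, ← pow_two, ZMod.natCast_self]

theorem n_mul_eq_iff (a b : ℕ) :
    (P.n : ZMod (P.n ^ 2)) * a = P.n * b ↔ (a : ZMod P.n) = b := by
  rw [← Nat.cast_mul, ← Nat.cast_mul, ZMod.natCast_eq_natCast_iff, ZMod.natCast_eq_natCast_iff,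
    pow_two]
  exact ⟨fun h => Nat.ModEq.mul_left_cancel' (NeZero.ne P.n) h, fun h => h.mul_left' _⟩

theorem coe_pow_lam (g : P.Cipher) :
    ((g ^ P.lam : P.Cipher) : ZMod (P.n ^ 2)) = 1 + P.n * (P.L (P.repr (g ^ P.lam)) : ℕ) := by
  conv_lhs => rw [← P.cast_repr, repr_pow_lam]
  push_cast
  rfl

/-- The homomorphism `g ↦ L(g^λ)`. -/
def logHom : P.Cipher →* Multiplicative (ZMod P.n) where
  toFun g := Multiplicative.ofAdd (P.logLam g)
  map_one' := by
    have h := P.coe_pow_lam 1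
    rw [one_pow, Units.val_one, eq_comm, add_eq_left] at h
    have h' := (P.n_mul_eq_iff (P.L (P.repr 1)) 0).1 (by rw [h, Nat.cast_zero, mul_zero])
    rw [logLam, one_pow, h', Nat.cast_zero]
    rfl
  map_mul' x y := by
    rw [← ofAdd_add]
    congr 1
    rw [logLam, logLam, logLam, ← Nat.cast_add, ← n_mul_eq_iff]
    -- Additivity is `(1 + na)(1 + nb) = 1 + n(a + b)`, valid because `n² = 0`.
    have h := congrArg Units.val (mul_pow x y P.lam)
    rw [Units.val_mul, coe_pow_lam, coe_pow_lam, coe_pow_lam] at h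
    push_cast
    linear_combination h + (P.L (P.repr (x ^ P.lam)) : ZMod (P.n ^ 2))
      * (P.L (P.repr (y ^ P.lam)) : ZMod (P.n ^ 2)) * P.n_mul_n_eq_zero

/-- The element `w = 1 + n` satisfies `w^m = 1 + nm`, so its image is `λ`, a unit modulo `n`; powers
of `w` therefore reach every residue. -/
theorem logHom_surjective : Function.Surjective P.logHom := by
  have hc : Nat.Coprime (1 + P.n) (P.n ^ 2) := by
    apply Nat.Coprime.pow_right
    simp
  let w : P.Cipher := ZMod.unitOfCoprime (1 + P.n) hc
  have hpow : ∀ m : ℕ, ((w ^ m : P.Cipher) : ZMod (P.n ^ 2)) = 1 + P.n * m := by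
    intro m
    induction m with
    | zero => simp
    | succ m ih =>
      rw [pow_succ w m, Units.val_mul, ih]
      simp only [w, ZMod.coe_unitOfCoprime]
      push_cast
      linear_combination (m : ZMod (P.n ^ 2)) * P.n_mul_n_eq_zero
  have hlog : P.logLam w = P.lam := by
    rw [logLam, ← n_mul_eq_iff]
    have := P.coe_pow_lam w
    rw [hpow] at this
    linear_combination -this
  have hu : IsUnit (P.lam : ZMod P.n) := (ZMod.isUnit_iff_coprime _ _).2 P.lam_coprime
  intro y
  refine ⟨w ^ (Multiplicative.toAdd y * (P.lam : ZMod P.n)⁻¹).val, ?_⟩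
  rw [map_pow]
  change Multiplicative.ofAdd (P.logLam w) ^ _ = y
  rw [← ofAdd_nsmul, hlog, nsmul_eq_mul, ZMod.natCast_zmod_val, mul_assoc,
    ZMod.inv_mul_of_unit _ hu, mul_one]
  rfl

open Classical in
/-- The proportion of admissible generators is `φ(n)/n`. -/
theorem card_base_mul : Fintype.card {g : P.Cipher // P.IsBase g} * P.n
    = P.n.totient * Fintype.card P.Cipher := by
  -- All fibres of the surjection have the same size `k`. The group consists of `n` fibres, the
  -- admissible generators of the `φ(n)` fibres over units.
  have hfib : ∀ y z : Multiplicative (ZMod P.n),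
      (Finset.univ.filter fun g => P.logHom g = y).card
        = (Finset.univ.filter fun g => P.logHom g = z).card := fun y z =>
    MonoidHom.card_fiber_eq_of_mem_range P.logHom
      (MonoidHom.mem_range.2 (P.logHom_surjective y)) (MonoidHom.mem_range.2 (P.logHom_surjective z))
  set k := (Finset.univ.filter fun g => P.logHom g = 1).card with hk
  have h1 : Fintype.card P.Cipher = P.n * k := by
    rw [← Finset.card_univ, Finset.card_eq_sum_card_fiberwise (f := P.logHom)
      (t := Finset.univ) (fun _ _ => Finset.mem_coe.2 (Finset.mem_univ _)),
      Finset.sum_congr rfl fun y _ => hfib y 1, Finset.sum_const, Finset.card_univ,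
      Fintype.card_multiplicative, ZMod.card, smul_eq_mul]
  have h2 : Fintype.card {g : P.Cipher // P.IsBase g} = P.n.totient * k := by
    have hset : (Finset.univ.filter fun y : Multiplicative (ZMod P.n) =>
        IsUnit (Multiplicative.toAdd y)).card = P.n.totient := by
      rw [← ZMod.card_units_eq_totient, ← Fintype.card_subtype]
      refine Fintype.card_congr ?_
      exact
        { toFun := fun y => y.2.unit
          invFun := fun u => ⟨Multiplicative.ofAdd (u : ZMod P.n), u.isUnit⟩
          left_inv := fun y => rfl
          right_inv := fun u => Units.ext rfl }
    have hmaps : Set.MapsTo P.logHom (Finset.univ.filter fun g => P.IsBase g : Finset P.Cipher)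
        (Finset.univ.filter fun y : Multiplicative (ZMod P.n) =>
          IsUnit (Multiplicative.toAdd y) : Finset _) := fun g hg =>
      Finset.mem_coe.2 (Finset.mem_filter.2 ⟨Finset.mem_univ _, (Finset.mem_filter.1 hg).2⟩)
    rw [Fintype.card_subtype, Finset.card_eq_sum_card_fiberwise hmaps, ← hset]
    rw [Finset.sum_congr rfl (g := fun _ => k), Finset.sum_const, smul_eq_mul]
    intro y hy
    rw [hk, ← hfib y 1, Finset.filter_filter]
    congr 1
    ext g
    simp only [Finset.mem_filter, Finset.mem_univ, true_and] at hy ⊢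
    refine ⟨fun h => h.2, fun h => ⟨?_, h⟩⟩
    rw [← h] at hy
    exact hy
  rw [h1, h2]
  ring

/-- Proportion of residues modulo `n` that are not invertible. -/
def nonUnitRatio : ℝ := 1 - P.n.totient / P.n

theorem nonUnitRatio_nonneg : 0 ≤ P.nonUnitRatio := by
  have hn : (0 : ℝ) < P.n := by exact_mod_cast Nat.pos_of_ne_zero (NeZero.ne P.n)
  rw [nonUnitRatio, sub_nonneg, div_le_one hn]
  exact_mod_cast Nat.totient_le _

/-- `1 - (1 - 1/p)(1 - 1/q) ≤ 1/p + 1/q`, and a number of at least `κ ≥ 1` bits is at least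
`2^(κ-1)`. -/
theorem nonUnitRatio_le {κ : ℕ} (hp : κ ≤ Nat.size P.p) (hq : κ ≤ Nat.size P.q) :
    P.nonUnitRatio ≤ 4 / 2 ^ κ := by
  have hbig : ∀ ℓ : ℕ, ℓ.Prime → κ ≤ Nat.size ℓ → (1 : ℝ) / ℓ ≤ 2 / 2 ^ κ := by
    intro ℓ hℓ hk
    have h1 : 2 ^ κ ≤ 2 * ℓ := by
      rcases Nat.eq_zero_or_pos κ with rfl | hpos
      · have := hℓ.one_lt
        omega
      · have h2 : 2 ^ (κ - 1) ≤ ℓ := Nat.lt_size.1 (by omega)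
        have h3 : 2 ^ κ = 2 * 2 ^ (κ - 1) := by rw [← pow_succ']; congr 1; omega
        omega
    have h1' : (2 : ℝ) ^ κ ≤ 2 * ℓ := by exact_mod_cast h1
    rw [div_le_div_iff₀ (by exact_mod_cast hℓ.pos) (by positivity)]
    linarith
  have hp0 : (0 : ℝ) < P.p := by exact_mod_cast P.prime_p.pos
  have hq0 : (0 : ℝ) < P.q := by exact_mod_cast P.prime_q.pos
  have hco : Nat.Coprime P.p P.q := (Nat.coprime_primes P.prime_p P.prime_q).2 P.ne
  have htot : (P.n.totient : ℝ) = (P.p - 1) * (P.q - 1) := by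
    rw [n, Nat.totient_mul hco, Nat.totient_prime P.prime_p, Nat.totient_prime P.prime_q]
    rw [Nat.cast_mul, Nat.cast_sub P.prime_p.one_le, Nat.cast_sub P.prime_q.one_le, Nat.cast_one]
  have h1 := hbig P.p P.prime_p hp
  have h2 := hbig P.q P.prime_q hq
  have : P.nonUnitRatio ≤ 1 / P.p + 1 / P.q := by
    rw [nonUnitRatio, htot, n, Nat.cast_mul]
    have : 1 - ((P.p : ℝ) - 1) * (P.q - 1) / (P.p * P.q) = 1 / P.p + 1 / P.q - 1 / (P.p * P.q) := by
      field_simp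
      ring
    rw [this]
    have : (0 : ℝ) ≤ 1 / (P.p * P.q) := by positivity
    linarith
  calc P.nonUnitRatio ≤ 2 / 2 ^ κ + 2 / 2 ^ κ := by linarith
    _ = 4 / 2 ^ κ := by ring

end PrimePair

/-! ### Probabilities of experiments -/

theorem prob_nonneg (e : PMF Bool) : 0 ≤ prob e := ENNReal.toReal_nonneg

theorem prob_le_one (e : PMF Bool) : prob e ≤ 1 :=
  ENNReal.toReal_mono ENNReal.one_ne_top (e.coe_le_one true)

section

variable {α β γ : Type}

theorem prob_bind (p : PMF α) (f : α → PMF Bool) :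
    prob (p.bind f) = ∑' a, (p a).toReal * prob (f a) := by
  rw [prob, PMF.bind_apply, ENNReal.tsum_toReal_eq fun a =>
    ENNReal.mul_ne_top (p.apply_ne_top a) ((f a).apply_ne_top true)]
  simp only [ENNReal.toReal_mul, prob]

theorem summable_toReal (p : PMF α) : Summable fun a => (p a).toReal :=
  ENNReal.summable_toReal p.tsum_coe_ne_top

theorem tsum_toReal (p : PMF α) : ∑' a, (p a).toReal = 1 := by
  rw [← ENNReal.tsum_toReal_eq p.apply_ne_top, p.tsum_coe, ENNReal.toReal_one]

theorem summable_mul_prob (p : PMF α) (f : α → PMF Bool) :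
    Summable fun a => (p a).toReal * prob (f a) :=
  (summable_toReal p).of_nonneg_of_le
    (fun _ => mul_nonneg ENNReal.toReal_nonneg (prob_nonneg _))
    (fun _ => mul_le_of_le_one_right ENNReal.toReal_nonneg (prob_le_one _))

theorem prob_bind_le (p : PMF α) (f g : α → PMF Bool) (δ : ℝ)
    (h : ∀ a ∈ p.support, prob (f a) ≤ prob (g a) + δ) :
    prob (p.bind f) ≤ prob (p.bind g) + δ := by
  have hδ : ∑' a, (p a).toReal * δ = δ := by rw [tsum_mul_right, tsum_toReal, one_mul]
  rw [prob_bind, prob_bind, ← hδ, ← (summable_mul_prob p g).tsum_add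
    ((summable_toReal p).mul_right δ)]
  refine (summable_mul_prob p f).tsum_le_tsum (fun a => ?_)
    ((summable_mul_prob p g).add ((summable_toReal p).mul_right δ))
  by_cases ha : a ∈ p.support
  · rw [← mul_add]
    exact mul_le_mul_of_nonneg_left (h a ha) ENNReal.toReal_nonneg
  · simp [(PMF.apply_eq_zero_iff p a).2 ha]

theorem abs_prob_bind_le (p : PMF α) (f g : α → PMF Bool) (δ : ℝ)
    (h : ∀ a ∈ p.support, |prob (f a) - prob (g a)| ≤ δ) :
    |prob (p.bind f) - prob (p.bind g)| ≤ δ := by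
  rw [abs_sub_le_iff]
  constructor
  · have := prob_bind_le p f g δ fun a ha => by
      have := (abs_sub_le_iff.1 (h a ha)).1
      linarith
    linarith
  · have := prob_bind_le p g f δ fun a ha => by
      have := (abs_sub_le_iff.1 (h a ha)).2
      linarith
    linarith

theorem prob_bind_eq_const (p : PMF α) (f : α → PMF Bool) (c : ℝ) (h : ∀ a, prob (f a) = c) :
    prob (p.bind f) = c := by
  rw [prob_bind]
  simp only [h]
  rw [tsum_mul_right, tsum_toReal, one_mul]

theorem prob_uniform_bind [Fintype α] [Nonempty α] (f : α → PMF Bool) :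
    prob ((PMF.uniformOfFintype α).bind f) = (∑ a, prob (f a)) / Fintype.card α := by
  rw [prob_bind, tsum_fintype, Finset.sum_div]
  refine Finset.sum_congr rfl fun a _ => ?_
  rw [PMF.uniformOfFintype_apply, ENNReal.toReal_inv, ENNReal.toReal_natCast]
  ring

/-! ### Statistical distance -/

/-- No test distinguishes `p` and `q` with advantage more than `δ`. -/
def StatClose (δ : ℝ) (p q : PMF α) : Prop :=
  ∀ f : α → PMF Bool, |prob (p.bind f) - prob (q.bind f)| ≤ δ

theorem StatClose.trans {δ ε : ℝ} {p q r : PMF α} (h₁ : StatClose δ p q) (h₂ : StatClose ε q r) :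
    StatClose (δ + ε) p r := fun f =>
  (abs_sub_le _ (prob (q.bind f)) _).trans (add_le_add (h₁ f) (h₂ f))

theorem StatClose.symm {δ : ℝ} {p q : PMF α} (h : StatClose δ p q) : StatClose δ q p := fun f => by
  rw [abs_sub_comm]
  exact h f

theorem StatClose.mono {δ ε : ℝ} {p q : PMF α} (h : StatClose δ p q) (hδ : δ ≤ ε) :
    StatClose ε p q := fun f => (h f).trans hδ

theorem StatClose.map {δ : ℝ} {p q : PMF α} (h : StatClose δ p q) (g : α → β) :
    StatClose δ (p.map g) (q.map g) := fun f => by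
  rw [PMF.bind_map, PMF.bind_map]
  exact h _

/-- A test takes values in `[0, 1]`, so its mean over `β` differs from its mean over the image of
`ι` by at most the proportion of points that the image misses. -/
theorem statClose_uniform [Fintype α] [Nonempty α] [Fintype β] [Nonempty β] (ι : α → β)
    (hι : Function.Injective ι) :
    StatClose (1 - (Fintype.card α : ℝ) / Fintype.card β) ((PMF.uniformOfFintype α).map ι)
      (PMF.uniformOfFintype β) := by
  classical
  intro f
  rw [PMF.bind_map, prob_uniform_bind, prob_uniform_bind]
  have hA : (0 : ℝ) < Fintype.card α := by exact_mod_cast Fintype.card_pos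
  have hB : (0 : ℝ) < Fintype.card β := by exact_mod_cast Fintype.card_pos
  have hcard : (Fintype.card α : ℝ) ≤ Fintype.card β := by
    exact_mod_cast Fintype.card_le_of_injective ι hι
  have hsplit : ∑ b, prob (f b) = ∑ a, prob (f (ι a))
      + ∑ b ∈ (Finset.univ.image ι)ᶜ, prob (f b) := by
    rw [← Finset.sum_add_sum_compl (Finset.univ.image ι), Finset.sum_image fun a _ b _ h => hι h]
  have hs0 : 0 ≤ ∑ a, prob (f (ι a)) := Finset.sum_nonneg fun _ _ => prob_nonneg _
  have hs1 : ∑ a, prob (f (ι a)) ≤ Fintype.card α := by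
    refine (Finset.sum_le_card_nsmul _ _ 1 fun _ _ => prob_le_one _).trans ?_
    simp
  have hr0 : 0 ≤ ∑ b ∈ (Finset.univ.image ι)ᶜ, prob (f b) :=
    Finset.sum_nonneg fun _ _ => prob_nonneg _
  have hr1 : ∑ b ∈ (Finset.univ.image ι)ᶜ, prob (f b) ≤ Fintype.card β - Fintype.card α := by
    refine (Finset.sum_le_card_nsmul _ _ 1 fun _ _ => prob_le_one _).trans ?_
    rw [Finset.card_compl, Finset.card_image_of_injective _ hι, Finset.card_univ, nsmul_eq_mul,
      mul_one, Nat.cast_sub (by exact_mod_cast hcard)]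
  simp only [Function.comp_def]
  rw [hsplit]
  generalize ∑ a, prob (f (ι a)) = s at *
  generalize ∑ b ∈ (Finset.univ.image ι)ᶜ, prob (f b) = r at *
  generalize (Fintype.card α : ℝ) = A at *
  generalize (Fintype.card β : ℝ) = B at *
  have h1 : s / A - (s + r) / B = (s / A) * (1 - A / B) - r / B := by
    field_simp
    ring
  have hsA : s / A ≤ 1 := (div_le_one hA).2 hs1
  have hsA0 : 0 ≤ s / A := by positivity
  have hAB : 0 ≤ 1 - A / B := sub_nonneg.2 ((div_le_one hB).2 hcard)
  have hrB : r / B ≤ 1 - A / B := by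
    rw [div_le_iff₀ hB, sub_mul, div_mul_cancel₀ _ hB.ne']
    linarith
  have hrB0 : 0 ≤ r / B := by positivity
  rw [h1, abs_le]
  constructor
  · have := mul_nonneg hsA0 hAB
    linarith
  · have := mul_le_of_le_one_left hAB hsA
    linarith

/-! ### Splitting uniform laws -/

theorem uniform_map_equiv [Fintype α] [Nonempty α] [Fintype β] [Nonempty β] (e : α ≃ β) :
    (PMF.uniformOfFintype α).map e = PMF.uniformOfFintype β := by
  ext b
  rw [PMF.map_apply, tsum_eq_single (e.symm b)]
  · simp [PMF.uniformOfFintype_apply, Fintype.card_congr e]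
  · intro a ha
    rw [if_neg]
    rintro rfl
    simp at ha

theorem uniform_prod_bind [Fintype α] [Nonempty α] [Fintype β] [Nonempty β]
    (F : α → β → PMF γ) : (PMF.uniformOfFintype (α × β)).bind (fun x => F x.1 x.2)
      = (PMF.uniformOfFintype α).bind fun a => (PMF.uniformOfFintype β).bind fun b => F a b := by
  ext c
  simp only [PMF.bind_apply, PMF.uniformOfFintype_apply, tsum_fintype, Fintype.sum_prod_type,
    Fintype.card_prod, Finset.mul_sum, Nat.cast_mul]
  refine Finset.sum_congr rfl fun a _ => Finset.sum_congr rfl fun b _ => ?_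
  rw [ENNReal.mul_inv (by simp) (by simp), mul_assoc]

/-- Remainder and quotient of a uniform number below `ab` are independent and uniform. With powers
of `2` this cuts one coin tape into independent tapes. -/
theorem uniform_fin_mul_bind {a b : ℕ} [NeZero a] [NeZero b] [NeZero (a * b)]
    (F : ℕ → ℕ → PMF γ) :
    (PMF.uniformOfFintype (Fin (a * b))).bind (fun ρ => F (ρ.val % a) (ρ.val / a))
      = (PMF.uniformOfFintype (Fin a)).bind fun x =>
          (PMF.uniformOfFintype (Fin b)).bind fun y => F x.val y.val := by
  have e : ∃ e : Fin a × Fin b ≃ Fin (a * b), ∀ x, (e x).val = x.1.val + a * x.2.val :=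
    ⟨(Equiv.prodComm _ _).trans (finProdFinEquiv.trans (finCongr (mul_comm b a))), fun x => rfl⟩
  obtain ⟨e, he⟩ := e
  rw [← uniform_prod_bind (fun (x : Fin a) (y : Fin b) => F x.val y.val), ← uniform_map_equiv e,
    PMF.bind_map]
  congr 1
  funext x
  rw [Function.comp_apply, he, Nat.add_mul_mod_self_left, Nat.mod_eq_of_lt x.1.2,
    Nat.add_mul_div_left _ _ (Nat.pos_of_ne_zero (NeZero.ne a)), Nat.div_eq_of_lt x.1.2, zero_add]

theorem uniform_tape_bind {a b c : ℕ} (hc : c = a + b) (F : ℕ → ℕ → PMF γ) :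
    (PMF.uniformOfFintype (Fin (2 ^ c))).bind (fun ρ => F (ρ.val % 2 ^ a) (ρ.val / 2 ^ a))
      = (PMF.uniformOfFintype (Fin (2 ^ a))).bind fun x =>
          (PMF.uniformOfFintype (Fin (2 ^ b))).bind fun y => F x.val y.val := by
  subst hc
  rw [← uniform_fin_mul_bind, ← uniform_map_equiv (finCongr (pow_add 2 a b)), PMF.bind_map]
  rfl

theorem uniform_bit_bind (F : Bool → PMF γ) :
    (PMF.uniformOfFintype (Fin (2 ^ 1))).bind (fun x => F (decide (x.val = 1)))
      = (PMF.uniformOfFintype Bool).bind F := by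
  have e : ∃ e : Fin (2 ^ 1) ≃ Bool, ∀ x, e x = decide (x.val = 1) :=
    ⟨finTwoEquiv, by decide⟩
  obtain ⟨e, he⟩ := e
  rw [← uniform_map_equiv e, PMF.bind_map]
  simp only [Function.comp_def, he]

/-- Below the largest multiple of `K` that is at most `M`, reduction modulo `K` is exactly uniform;
fewer than `K` of the `M` values lie beyond it. -/
theorem statClose_mod {K M : ℕ} [NeZero K] [NeZero M] (h : K ≤ M) :
    StatClose ((K : ℝ) / M) ((PMF.uniformOfFintype (Fin M)).map fun ρ => ρ.val % K)
      ((PMF.uniformOfFintype (Fin K)).map Fin.val) := by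
  have hK : 0 < K := Nat.pos_of_ne_zero (NeZero.ne K)
  have hM : (0 : ℝ) < M := by exact_mod_cast Nat.pos_of_ne_zero (NeZero.ne M)
  let c := M / K
  have hc : 0 < c := Nat.div_pos h hK
  have : NeZero c := ⟨hc.ne'⟩
  have : NeZero (K * c) := ⟨(Nat.mul_pos hK hc).ne'⟩
  have hle : K * c ≤ M := Nat.mul_div_le M K
  have hlt : M < K * c + K := by
    have h₁ := Nat.div_add_mod M K
    have h₂ := Nat.mod_lt M hK
    simp only [c]
    omega
  have h₁ := (statClose_uniform (Fin.castLE hle) (Fin.castLE_injective hle)).map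
    fun ρ => ρ.val % K
  rw [PMF.map_comp] at h₁
  have h₂ : (PMF.uniformOfFintype (Fin (K * c))).map (fun ρ => ρ.val % K)
      = (PMF.uniformOfFintype (Fin K)).map Fin.val := by
    have := uniform_fin_mul_bind (a := K) (b := c) fun x _ => PMF.pure x
    simp only [PMF.bind_const] at this
    exact this
  have h₃ : ((fun ρ : Fin M => ρ.val % K) ∘ Fin.castLE hle) = fun ρ => ρ.val % K := rfl
  rw [h₃, h₂, Fintype.card_fin, Fintype.card_fin] at h₁
  refine h₁.symm.mono ?_
  rw [sub_le_iff_le_add, ← add_div, le_div_iff₀ hM, one_mul]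
  exact_mod_cast (by omega : M ≤ K + K * c)

end

/-! ### Negligible functions -/

theorem Negligible.of_le {ε η : ℕ → ℝ} (hη : Negligible η) (h : ∀ κ, |ε κ| ≤ η κ) :
    Negligible ε :=
  SuperpolynomialDecay.trans_abs_le hη fun κ => (h κ).trans (le_abs_self _)

theorem negligible_poly_div_two_pow (Q : Polynomial ℕ) :
    Negligible fun κ => ((Q.eval κ : ℕ) : ℝ) / 2 ^ κ := by
  have h : Negligible fun κ => ((2 : ℝ) ^ κ)⁻¹ := fun k => by
    simpa [div_eq_mul_inv] using tendsto_pow_const_div_const_pow_of_one_lt k (one_lt_two (α := ℝ))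
  have := SuperpolynomialDecay.polynomial_mul h (Q.map (Nat.castRingHom ℝ))
  refine this.congr fun κ => ?_
  rw [Polynomial.eval_natCast_map, div_eq_mul_inv]
  rfl

/-! ### Sampling the view from coins -/

/-- The view computed from the coins in `ρ`; its base-`n` digits are the encryption randomness. -/
def simView (N d t : ℕ → ℕ) (u : Unary) (n g : ℕ) (f : List Bool) (h : Histories) (ρ : ℕ) : View :=
  natView n g ⟨N u.len⟩ ⟨d u.len⟩ ⟨t u.len⟩ f h
    (digitList n ρ (List.replicate (N u.len * d u.len) (1 : ℕ)))

theorem EfficientParam.comp {α : Type} [ToData α] {N : ℕ → ℕ} (hN : EfficientParam N)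
    {u : α → Unary} (hu : PolyTime u) : PolyTime fun a => (⟨N (u a).len⟩ : Unary) :=
  PolyTime.comp (g := fun u : Unary => (⟨N u.len⟩ : Unary)) hN hu

theorem PolyTime.simView {α : Type} [ToData α] {N d t : ℕ → ℕ} (hN : EfficientParam N)
    (hd : EfficientParam d) (ht : EfficientParam t) {u : α → Unary} {n g ρ : α → ℕ}
    {f : α → List Bool} {h : α → Histories} (hu : PolyTime u) (hn : PolyTime n) (hg : PolyTime g)
    (hf : PolyTime f) (hh : PolyTime h) (hρ : PolyTime ρ) :
    PolyTime fun a => simView N d t (u a) (n a) (g a) (f a) (h a) (ρ a) :=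
  .natView hn hg (hN.comp hu) (hd.comp hu) (ht.comp hu) hf hh
    (.digitList hn hρ (PolyTime.len_list ((hN.mul hd).comp hu)))

theorem digit_mod (n ρ : ℕ) {j K : ℕ} (h : j < K) : ρ % n ^ K / n ^ j % n = ρ / n ^ j % n := by
  have hK : n ^ K = n ^ j * n ^ (K - j) := by rw [← pow_add]; congr 1; omega
  rw [hK, Nat.mod_mul_right_div_self, Nat.mod_mod_of_dvd]
  exact dvd_pow_self n (by omega)

theorem digitList_mod {β : Type} (n ρ : ℕ) (l : List β) :
    digitList n (ρ % n ^ l.length) l = digitList n ρ l := by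
  rw [digitList_eq, digitList_eq]
  refine List.map_congr_left fun j hj => ?_
  exact digit_mod n ρ (List.mem_range.1 hj)

variable (P : PrimePair)

/-- The number whose base-`n` digits represent a family of units. -/
def packUnits (N d : ℕ) (r : Fin N → Fin d → (ZMod P.n)ˣ) : Fin (P.n ^ (N * d)) :=
  finFunctionFinEquiv fun j => ⟨(r (finProdFinEquiv.symm j).1 (finProdFinEquiv.symm j).2 :
    ZMod P.n).val, ZMod.val_lt _⟩

theorem packUnits_digit (N d : ℕ) (r : Fin N → Fin d → (ZMod P.n)ˣ) (i : Fin N) (k : Fin d) :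
    (packUnits P N d r).val / P.n ^ (i.val * d + k.val) % P.n = (r i k : ZMod P.n).val := by
  have h : (finFunctionFinEquiv.symm (packUnits P N d r) (finProdFinEquiv (i, k))).val
      = (r i k : ZMod P.n).val := by
    simp only [packUnits, Equiv.symm_apply_apply]
  rw [← h]
  change _ = (packUnits P N d r).val / P.n ^ (k.val + d * i.val) % P.n
  rw [mul_comm d, add_comm]

theorem packUnits_injective (N d : ℕ) : Function.Injective (packUnits P N d) := by
  intro r s h
  funext i k
  apply Units.ext
  apply ZMod.val_injective
  rw [← packUnits_digit, ← packUnits_digit, h]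

theorem mul_add_lt {N d : ℕ} (i : Fin N) (k : Fin d) : i.val * d + k.val < N * d := by
  have h₁ : (i.val + 1) * d ≤ N * d := Nat.mul_le_mul_right _ i.2
  have h₂ := k.2
  rw [Nat.succ_mul] at h₁
  omega

theorem simView_packUnits (N d t : ℕ → ℕ) (κ : ℕ) (g : P.Cipher) (f : List Bool) (h : Histories)
    (r : Fin (N κ) → Fin (d κ) → (ZMod P.n)ˣ) :
    simView N d t ⟨κ⟩ P.n (P.repr g) f h (packUnits P (N κ) (d κ) r)
      = view P g (N κ) (d κ) (t κ) f h r := by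
  refine natView_eq P g _ _ _ f h r _ fun i k => ?_
  rw [digitList_eq, List.length_replicate, List.getD_eq_getElem _ _ (by simpa using mul_add_lt i k),
    List.getElem_map, List.getElem_range, packUnits_digit]

/-- Two errors arise. Reducing `m` coins modulo `n^(Nd)` costs at most `n^(Nd) / 2^m ≤ 2^(-κ)`. The
resulting digits are uniform residues instead of uniform units, which costs at most the probability
that one of them is not invertible; on units the computed view is exact. -/
theorem statClose_simView (N d t : ℕ → ℕ) (κ m : ℕ) (g : P.Cipher) (f : List Bool) (h : Histories)
    (hm : P.n ^ (N κ * d κ) * 2 ^ κ ≤ 2 ^ m) :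
    StatClose (1 / 2 ^ κ + (N κ * d κ : ℕ) * P.nonUnitRatio)
      ((PMF.uniformOfFintype (Fin (2 ^ m))).map fun ρ =>
        simView N d t ⟨κ⟩ P.n (P.repr g) f h ρ.val)
      (viewLaw P g (N κ) (d κ) (t κ) f h) := by
  set K := N κ * d κ with hK
  let G : ℕ → View := fun ρ => simView N d t ⟨κ⟩ P.n (P.repr g) f h ρ
  have hG : ∀ ρ, G (ρ % P.n ^ K) = G ρ := fun ρ => by
    have := digitList_mod P.n ρ (List.replicate K (1 : ℕ))
    rw [List.length_replicate] at this
    simp only [G, simView]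
    rw [← hK, this]
  have hn : 0 < P.n := Nat.pos_of_ne_zero (NeZero.ne _)
  have : NeZero (P.n ^ K) := ⟨(pow_pos hn K).ne'⟩
  have hle : P.n ^ K ≤ 2 ^ m := (Nat.le_mul_of_pos_right _ (by positivity)).trans hm
  have h₁ := (statClose_mod hle).map G
  rw [PMF.map_comp, PMF.map_comp] at h₁
  have hG' : G ∘ (fun ρ : Fin (2 ^ m) => ρ.val % P.n ^ K) = fun ρ => G ρ.val :=
    funext fun ρ => hG ρ.val
  rw [hG'] at h₁
  have h₂ := ((statClose_uniform (packUnits P (N κ) (d κ))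
    (packUnits_injective P _ _)).map (G ∘ Fin.val)).symm
  rw [PMF.map_comp] at h₂
  have hview : (G ∘ Fin.val) ∘ packUnits P (N κ) (d κ) = view P g (N κ) (d κ) (t κ) f h :=
    funext fun r => simView_packUnits P N d t κ g f h r
  rw [hview] at h₂
  refine (h₁.trans h₂).mono (add_le_add ?_ ?_)
  · rw [div_le_div_iff₀ (by positivity) (by positivity), one_mul]
    exact_mod_cast hm
  · have hcard : (Fintype.card (Fin (N κ) → Fin (d κ) → (ZMod P.n)ˣ) : ℝ)
        / Fintype.card (Fin (P.n ^ (N κ * d κ))) = ((P.n.totient : ℝ) / P.n) ^ K := by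
      rw [Fintype.card_fun, Fintype.card_fun, Fintype.card_fin, Fintype.card_fin, Fintype.card_fin,
        ZMod.card_units_eq_totient, ← pow_mul, mul_comm (d κ), ← hK, div_pow]
      push_cast
      rfl
    rw [hcard]
    -- Bernoulli's inequality: `(φ(n)/n)^K ≥ 1 - K(1 - φ(n)/n)`.
    have hb := one_add_mul_le_pow (a := -P.nonUnitRatio) (by
      have : P.nonUnitRatio ≤ 1 := by
        rw [PrimePair.nonUnitRatio, sub_le_self_iff]
        positivity
      linarith) K
    have : 1 + -P.nonUnitRatio = (P.n.totient : ℝ) / P.n := by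
      rw [PrimePair.nonUnitRatio]
      ring
    rw [this] at hb
    linarith

theorem statClose_baseLaw : StatClose P.nonUnitRatio (P.baseLaw.map Subtype.val)
    (PMF.uniformOfFintype P.Cipher) := by
  classical
  refine (statClose_uniform _ Subtype.val_injective).mono (le_of_eq ?_)
  rw [PrimePair.nonUnitRatio]
  congr 1
  have hn : (P.n : ℝ) ≠ 0 := by exact_mod_cast NeZero.ne P.n
  have hc : (Fintype.card P.Cipher : ℝ) ≠ 0 := by exact_mod_cast Fintype.card_ne_zero
  rw [div_eq_div_iff hc hn]
  have := P.card_base_mul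
  exact_mod_cast this

/-! ### Lossy keys -/

/-- The plaintexts enter only through a translation of the uniform randomness by `z^c` modulo `n`,
one factor for each coordinate, and the uniform law is invariant under translation. -/
theorem viewLaw_pow_n (z : P.Cipher) (N d t : ℕ) (f : List Bool) (h h' : Histories) :
    viewLaw P (z ^ P.n) N d t f h = viewLaw P (z ^ P.n) N d t f h' := by
  have key : ∀ h, viewLaw P (z ^ P.n) N d t f h
      = (PMF.uniformOfFintype (Fin N → Fin d → (ZMod P.n)ˣ)).map fun r =>
        let x : Fin N → Fin d → P.Cipher := fun i k => P.lift (r i k) ^ P.n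
        (statusList N f, List.ofFn fun i => List.ofFn fun k => P.repr (x i k),
          List.ofFn fun k => P.repr (aggregate P f x k)) := by
    intro h
    let s : Fin N → Fin d → (ZMod P.n)ˣ := fun i k => P.red z ^ (update P d t f h i k).val
    let W : (Fin N → Fin d → (ZMod P.n)ˣ) → View := fun r =>
      let x : Fin N → Fin d → P.Cipher := fun i k => P.lift (r i k) ^ P.n
      (statusList N f, List.ofFn fun i => List.ofFn fun k => P.repr (x i k),
        List.ofFn fun k => P.repr (aggregate P f x k))
    have hW : view P (z ^ P.n) N d t f h = W ∘ Equiv.mulLeft s := by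
      funext r
      have hx : uploads P (z ^ P.n) N d t f h r
          = fun i k => P.lift (Equiv.mulLeft s r i k) ^ P.n := by
        funext i k
        rw [uploads, P.enc_pow_n]
        rfl
      unfold view
      rw [hx]
      rfl
    rw [viewLaw, hW, ← PMF.map_comp, uniform_map_equiv]
  rw [key h, key h']

/-- The sampler may output a status list of any length, while the blind algorithm receives exactly
`N` entries. -/
theorem viewLaw_statusList (g : P.Cipher) (N d t : ℕ) (f : List Bool) (h : Histories) :
    viewLaw P g N d t (statusList N f) h = viewLaw P g N d t f h := by
  have hs : ∀ i : Fin N, status (statusList N f) i = status f i := fun i => getD_ofFn _ i true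
  have hl : statusList N (statusList N f) = statusList N f := by
    rw [statusList]
    simp only [hs]
    rfl
  have hv : view P g N d t (statusList N f) h = view P g N d t f h := by
    funext r
    have hx : uploads P g N d t (statusList N f) h r = uploads P g N d t f h r := by
      funext i k
      simp only [uploads, update, hs]
    unfold view
    rw [hx, hl]
    simp only [aggregate, hs]
  rw [viewLaw, hv, viewLaw]

/-! ### Experiments on the key -/

/-- An experiment that depends on the key `(P, g)`, run on an honest key. -/
def honestGame (gen : PrimeGen) (inner : ℕ → (P : PrimePair) → P.Cipher → PMF Bool) (κ : ℕ) :
    PMF Bool :=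
  (gen.law κ).bind fun P => P.baseLaw.bind fun g => inner κ P g.1

/-- The same experiment with an `n`-th power in place of the generator. -/
def lossyGame (gen : PrimeGen) (inner : ℕ → (P : PrimePair) → P.Cipher → PMF Bool) (κ : ℕ) :
    PMF Bool :=
  (gen.law κ).bind fun P => (PMF.uniformOfFintype P.Cipher).bind fun z => inner κ P (z ^ P.n)

/-- `D` plays the experiment, up to `δ`, with the challenge as generator. An `n`-th power gives the
lossy experiment, and a uniform element gives the honest one up to the density of inadmissible
generators. -/
theorem negligible_honest_sub_lossy {gen : PrimeGen} (hDCR : DCR gen)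
    (inner : ℕ → (P : PrimePair) → P.Cipher → PMF Bool) (D : PPT (Unary × ℕ × ℕ) Bool)
    {δ : ℕ → ℝ} (hδ : Negligible δ) (hD : ∀ κ, ∀ P ∈ (gen.law κ).support, ∀ g : P.Cipher,
      |prob (D.run κ (⟨κ⟩, P.n, P.repr g)) - prob (inner κ P g)| ≤ δ κ) :
    Negligible fun κ => |prob (honestGame gen inner κ) - prob (lossyGame gen inner κ)| := by
  have h4 := negligible_poly_div_two_pow (Polynomial.C 4)
  simp only [Polynomial.eval_C] at h4
  refine Negligible.of_le (((hDCR D).add (hδ.add hδ)).add h4) fun κ => ?_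
  have hreal : |prob (dcrGame gen D true κ) - prob (lossyGame gen inner κ)| ≤ δ κ :=
    abs_prob_bind_le _ _ _ _ fun P hP => abs_prob_bind_le _ _ _ _ fun z _ => hD κ P hP (z ^ P.n)
  have hrand : |prob (honestGame gen inner κ) - prob (dcrGame gen D false κ)|
      ≤ ((4 : ℕ) : ℝ) / 2 ^ κ + δ κ :=
    abs_prob_bind_le _ _ _ _ fun P hP => by
      have h₁ := statClose_baseLaw P (inner κ P)
      rw [PMF.bind_map] at h₁
      have h₂ : |prob ((PMF.uniformOfFintype P.Cipher).bind fun z =>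
          D.run κ (⟨κ⟩, P.n, P.repr z)) - prob ((PMF.uniformOfFintype P.Cipher).bind (inner κ P))|
          ≤ δ κ := abs_prob_bind_le _ _ _ _ fun z _ => hD κ P hP z
      have h₃ := P.nonUnitRatio_le (gen.large κ P hP).1 (gen.large κ P hP).2
      rw [abs_sub_comm] at h₂
      exact (abs_sub_le _ _ _).trans
        (add_le_add (h₁.trans (by exact_mod_cast h₃)) h₂)
  rw [abs_abs]
  simp only [Pi.add_apply]
  have h₁ := abs_sub_le (prob (honestGame gen inner κ)) (prob (dcrGame gen D false κ))
    (prob (lossyGame gen inner κ))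
  have h₂ := abs_sub_le (prob (dcrGame gen D false κ)) (prob (dcrGame gen D true κ))
    (prob (lossyGame gen inner κ))
  rw [abs_sub_comm (prob (dcrGame gen D false κ)) (prob (dcrGame gen D true κ))] at h₂
  linarith

theorem PPT.run_bind {α β γ : Type} [ToData α] [ToData β] (A : PPT α β) (κ : ℕ) (a : α)
    (F : β → PMF γ) : (A.run κ a).bind F
      = (PMF.uniformOfFintype (Fin (2 ^ A.coins.eval κ))).bind fun ρ => F (A.fn (ρ.val, a)) := by
  rw [PPT.run, PMF.bind_map]
  rfl

theorem map_eq_bind {α β : Type} (p : PMF α) (f : α → β) :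
    p.map f = p.bind fun a => PMF.pure (f a) := rfl

/-! ### Coins for the view -/

theorem exists_viewCoins (gen : PrimeGen) {N d : ℕ → ℕ} (hN : EfficientParam N)
    (hd : EfficientParam d) : ∃ m : Polynomial ℕ, ∀ κ, ∀ P ∈ (gen.law κ).support,
      P.n ^ (N κ * d κ) * 2 ^ κ ≤ 2 ^ m.eval κ := by
  obtain ⟨Q, hQ⟩ := (hN.mul hd).exists_le
  -- `n` is at most `2^(2 * maxBits)` and `N * d` at most `Q`; the summand `X` supplies the `κ`
  -- spare coins that make reduction nearly unbiased.
  refine ⟨2 * gen.maxBits * Q + Polynomial.X, fun κ P hP => ?_⟩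
  have hb := gen.bounded κ P hP
  have hn : P.n ≤ 2 ^ (2 * gen.maxBits.eval κ) := by
    rw [PrimePair.n, two_mul, pow_add]
    exact Nat.mul_le_mul (Nat.size_le.1 hb.1).le (Nat.size_le.1 hb.2).le
  simp only [Polynomial.eval_add, Polynomial.eval_mul, Polynomial.eval_X, Polynomial.eval_ofNat]
  rw [pow_add]
  refine Nat.mul_le_mul_right _ ?_
  calc P.n ^ (N κ * d κ) ≤ (2 ^ (2 * gen.maxBits.eval κ)) ^ (N κ * d κ) :=
        Nat.pow_le_pow_left hn _
    _ ≤ (2 ^ (2 * gen.maxBits.eval κ)) ^ Q.eval κ :=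
        Nat.pow_le_pow_right (by positivity) (hQ κ)
    _ = 2 ^ (2 * gen.maxBits.eval κ * Q.eval κ) := by rw [← pow_mul]

/-- The law of the view computed from `m` coins. -/
def coinView (N d t : ℕ → ℕ) (m κ : ℕ) (P : PrimePair) (g : P.Cipher) (f : List Bool)
    (h : Histories) : PMF View :=
  (PMF.uniformOfFintype (Fin (2 ^ m))).map fun ρ => simView N d t ⟨κ⟩ P.n (P.repr g) f h ρ.val

theorem exists_statClose_coinView (gen : PrimeGen) {N d : ℕ → ℕ} (t : ℕ → ℕ)
    (hN : EfficientParam N) (hd : EfficientParam d) :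
    ∃ (m : Polynomial ℕ) (δ : ℕ → ℝ), Negligible δ ∧ ∀ κ, ∀ P ∈ (gen.law κ).support,
      ∀ (g : P.Cipher) (f : List Bool) (h : Histories),
        StatClose (δ κ) (coinView N d t (m.eval κ) κ P g f h)
          (viewLaw P g (N κ) (d κ) (t κ) f h) := by
  obtain ⟨m, hm⟩ := exists_viewCoins gen hN hd
  obtain ⟨Q, hQ⟩ := (hN.mul hd).exists_le
  refine ⟨m, _, negligible_poly_div_two_pow (1 + Q * 4), fun κ P hP g f h => ?_⟩
  refine (statClose_simView P N d t κ (m.eval κ) g f h (hm κ P hP)).mono ?_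
  have h₁ := P.nonUnitRatio_le (gen.large κ P hP).1 (gen.large κ P hP).2
  have h₂ : ((N κ * d κ : ℕ) : ℝ) ≤ (Q.eval κ : ℕ) := by exact_mod_cast hQ κ
  have h₃ := mul_le_mul h₂ h₁ P.nonUnitRatio_nonneg (by positivity)
  simp only [Polynomial.eval_add, Polynomial.eval_mul, Polynomial.eval_one, Polynomial.eval_ofNat]
  push_cast at h₃ ⊢
  rw [add_div, mul_div_assoc]
  linarith

@[fun_prop]
theorem PolyTime.coins {α : Type} [ToData α] (Q : Polynomial ℕ) {u : α → Unary}
    (hu : PolyTime u) : PolyTime fun a => 2 ^ Q.eval (u a).len :=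
  PolyTime.two_pow_len ((EfficientParam.eval Q).comp hu)

@[fun_prop]
theorem PolyTime.ppt {α β γ : Type} [ToData α] [ToData β] [ToData γ] (A : PPT α β)
    {f : γ → ℕ × α} (hf : PolyTime f) : PolyTime fun c => A.fn (f c) :=
  A.polyTime.comp hf

/-! ### Indistinguishability -/

section Indistinguishability

variable (N d t : ℕ → ℕ) (A : PPT Pub (List Bool × Histories × Histories × Data))
  (B : PPT (Pub × View × Data) Bool)

/-- The indistinguishability experiment for a given key. -/
def indInner (κ : ℕ) (P : PrimePair) (g : P.Cipher) : PMF Bool :=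
  (A.run κ (⟨κ⟩, P.n, P.repr g)).bind fun c => (PMF.uniformOfFintype Bool).bind fun b =>
    (viewLaw P g (N κ) (d κ) (t κ) c.1 (if b then c.2.1 else c.2.2.1)).bind fun v =>
      (B.run κ ((⟨κ⟩, P.n, P.repr g), v, c.2.2.2)).bind fun b' => PMF.pure (b' == b)

theorem indGame_eq (gen : PrimeGen) (κ : ℕ) :
    indGame gen N d t A B κ = honestGame gen (indInner N d t A B) κ := rfl

/-- The view does not depend on `b`, so `b` can be drawn after the answer `b'`, and a fair coin
agrees with a fixed bit with probability `1/2`. -/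
theorem prob_indInner_pow_n (κ : ℕ) (P : PrimePair) (z : P.Cipher) :
    prob (indInner N d t A B κ P (z ^ P.n)) = 1 / 2 := by
  refine prob_bind_eq_const _ _ _ fun c => ?_
  simp only [viewLaw_pow_n P z (N κ) (d κ) (t κ) c.1 _ []]
  rw [PMF.bind_comm]
  refine prob_bind_eq_const _ _ _ fun v => ?_
  rw [PMF.bind_comm]
  refine prob_bind_eq_const _ _ _ fun b' => ?_
  rw [prob_uniform_bind]
  cases b' <;> simp [prob]

/-- The distinguisher for composite residuosity that runs the indistinguishability experiment with
the challenge as generator. -/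
def indDistinguisher (m : Polynomial ℕ) (hN : EfficientParam N) (hd : EfficientParam d)
    (ht : EfficientParam t) : PPT (Unary × ℕ × ℕ) Bool where
  -- The tape is read from its low end: coins of `A`, the bit `b`, coins of the view, coins of `B`.
  coins := A.coins + (1 + (m + B.coins))
  fn x :=
    let u := x.2.1
    let c := A.fn (x.1 % 2 ^ A.coins.eval u.len, x.2)
    let ρ := x.1 / 2 ^ A.coins.eval u.len
    let b := decide (ρ % 2 = 1)
    let v := simView N d t u x.2.2.1 x.2.2.2 c.1 (bif b then c.2.1 else c.2.2.1)
      (ρ / 2 % 2 ^ m.eval u.len)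
    B.fn (ρ / 2 / 2 ^ m.eval u.len, x.2, v, c.2.2.2) == b
  polyTime := by
    have hv {α : Type} [ToData α] {u : α → Unary} {n g ρ : α → ℕ}
        {f : α → List Bool} {h : α → Histories} (hu : PolyTime u) (hn : PolyTime n)
        (hg : PolyTime g) (hf : PolyTime f) (hh : PolyTime h) (hρ : PolyTime ρ) :=
      PolyTime.simView hN hd ht hu hn hg hf hh hρ
    refine .beq (.ppt B (.mk (by fun_prop) (.mk (by fun_prop) (.mk
      (hv ?_ ?_ ?_ ?_ ?_ ?_) ?_)))) ?_ <;> fun_prop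

/-- Cutting the tape reproduces the experiment exactly, except that the view is computed from coins
instead of ideal randomness. -/
theorem abs_indDistinguisher_sub_le (m : Polynomial ℕ) (hN : EfficientParam N)
    (hd : EfficientParam d) (ht : EfficientParam t) (κ : ℕ) (P : PrimePair) (g : P.Cipher) (δ : ℝ)
    (hδ : ∀ f h, StatClose δ (coinView N d t (m.eval κ) κ P g f h)
      (viewLaw P g (N κ) (d κ) (t κ) f h)) :
    |prob ((indDistinguisher N d t A B m hN hd ht).run κ (⟨κ⟩, P.n, P.repr g))
      - prob (indInner N d t A B κ P g)| ≤ δ := by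
  have hrun : (indDistinguisher N d t A B m hN hd ht).run κ (⟨κ⟩, P.n, P.repr g)
      = (A.run κ (⟨κ⟩, P.n, P.repr g)).bind fun c => (PMF.uniformOfFintype Bool).bind fun b =>
        (coinView N d t (m.eval κ) κ P g c.1 (bif b then c.2.1 else c.2.2.1)).bind fun v =>
          (B.run κ ((⟨κ⟩, P.n, P.repr g), v, c.2.2.2)).bind fun b' => PMF.pure (b' == b) := by
    let pub : Pub := (⟨κ⟩, P.n, P.repr g)
    let out : List Bool × Histories × Histories × Data → Bool → ℕ → ℕ → PMF Bool :=
      fun c b x y => PMF.pure (B.fn (y, pub, simView N d t ⟨κ⟩ P.n (P.repr g) c.1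
        (bif b then c.2.1 else c.2.2.1) x, c.2.2.2) == b)
    rw [PPT.run, map_eq_bind, PPT.run_bind]
    refine (uniform_tape_bind (Polynomial.eval_add) fun x ρ => out (A.fn (x, pub))
      (decide (ρ % 2 = 1)) (ρ / 2 % 2 ^ m.eval κ) (ρ / 2 / 2 ^ m.eval κ)).trans ?_
    congr 1
    funext x
    rw [← uniform_bit_bind]
    refine (uniform_tape_bind (a := 1) (b := m.eval κ + B.coins.eval κ) (by simp) fun y ρ =>
      out (A.fn (x, pub)) (decide (y = 1)) (ρ % 2 ^ m.eval κ) (ρ / 2 ^ m.eval κ)).trans ?_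
    congr 1
    funext y
    rw [coinView, PMF.bind_map]
    refine (uniform_tape_bind rfl fun v ρ =>
      out (A.fn (x, pub)) (decide (y.val = 1)) v ρ).trans ?_
    congr 1
    funext v
    rw [Function.comp_apply, PPT.run_bind]
  rw [hrun]
  exact abs_prob_bind_le _ _ _ _ fun c _ => abs_prob_bind_le _ _ _ _ fun b _ => by
    cases b <;> exact hδ _ _ _

theorem negligible_indGame {gen : PrimeGen} (hDCR : DCR gen) (hN : EfficientParam N)
    (hd : EfficientParam d) (ht : EfficientParam t) :
    Negligible fun κ => |prob (indGame gen N d t A B κ) - 1 / 2| := by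
  obtain ⟨m, δ, hδ, hclose⟩ := exists_statClose_coinView gen t hN hd
  have h := negligible_honest_sub_lossy hDCR (indInner N d t A B)
    (indDistinguisher N d t A B m hN hd ht) hδ fun κ P hP g =>
      abs_indDistinguisher_sub_le N d t A B m hN hd ht κ P g _ (hclose κ P hP g)
  have hlossy : ∀ κ, prob (lossyGame gen (indInner N d t A B) κ) = 1 / 2 := fun κ =>
    prob_bind_eq_const _ _ _ fun P => prob_bind_eq_const _ _ _ fun z =>
      prob_indInner_pow_n N d t A B κ P z
  simpa only [indGame_eq, hlossy] using h

end Indistinguishability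

/-! ### No recovery -/

section Recovery

variable (N d t : ℕ → ℕ) (S : PPT Pub (List Bool × Histories × Data))
  (M : PPT (Pub × View × Data) Claim) (sel : Histories → Histories)

/-- The recovery experiment for a given key, with the uploads of the histories changed by `sel`. -/
def recoverInner (κ : ℕ) (P : PrimePair) (g : P.Cipher) : PMF Bool :=
  (S.run κ (⟨κ⟩, P.n, P.repr g)).bind fun c =>
    (viewLaw P g (N κ) (d κ) (t κ) c.1 (sel c.2.1)).bind fun v =>
      (M.run κ ((⟨κ⟩, P.n, P.repr g), v, c.2.2)).bind fun w =>
        PMF.pure (Claim.correct P (N κ) (d κ) (t κ) c.2.1 w)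

theorem recoverGame_eq (gen : PrimeGen) (κ : ℕ) :
    recoverGame gen N d t S M κ = honestGame gen (recoverInner N d t S M id) κ := rfl

theorem recoverInner_pow_n (κ : ℕ) (P : PrimePair) (z : P.Cipher) :
    recoverInner N d t S M sel κ P (z ^ P.n)
      = recoverInner N d t S M (fun _ => []) κ P (z ^ P.n) := by
  simp only [recoverInner, viewLaw_pow_n P z (N κ) (d κ) (t κ) _ (sel _) []]

/-- The distinguisher for composite residuosity that runs the recovery experiment with the challenge
as generator. -/
def recoverDistinguisher (hsel : PolyTime sel) (m : Polynomial ℕ) (hN : EfficientParam N)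
    (hd : EfficientParam d) (ht : EfficientParam t) : PPT (Unary × ℕ × ℕ) Bool where
  coins := S.coins + (m + M.coins)
  fn x :=
    let u := x.2.1
    let c := S.fn (x.1 % 2 ^ S.coins.eval u.len, x.2)
    let ρ := x.1 / 2 ^ S.coins.eval u.len
    let v := simView N d t u x.2.2.1 x.2.2.2 c.1 (sel c.2.1) (ρ % 2 ^ m.eval u.len)
    natCorrect x.2.2.1 ⟨N u.len⟩ ⟨d u.len⟩ ⟨t u.len⟩ c.2.1
      (M.fn (ρ / 2 ^ m.eval u.len, x.2, v, c.2.2))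
  polyTime := by
    have hu : PolyTime fun x : ℕ × Unary × ℕ × ℕ => x.2.1 := by fun_prop
    refine .natCorrect ?_ (hN.comp hu) (hd.comp hu) (ht.comp hu) ?_
      (.ppt M (.mk ?_ (.mk ?_ (.mk (.simView hN hd ht hu ?_ ?_ ?_ (hsel.comp ?_) ?_) ?_)))) <;>
      fun_prop

theorem abs_recoverDistinguisher_sub_le (hsel : PolyTime sel) (m : Polynomial ℕ)
    (hN : EfficientParam N) (hd : EfficientParam d) (ht : EfficientParam t) (κ : ℕ) (P : PrimePair)
    (g : P.Cipher) (δ : ℝ) (hδ : ∀ f h, StatClose δ (coinView N d t (m.eval κ) κ P g f h)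
      (viewLaw P g (N κ) (d κ) (t κ) f h)) :
    |prob ((recoverDistinguisher N d t S M sel hsel m hN hd ht).run κ (⟨κ⟩, P.n, P.repr g))
      - prob (recoverInner N d t S M sel κ P g)| ≤ δ := by
  have hrun : (recoverDistinguisher N d t S M sel hsel m hN hd ht).run κ (⟨κ⟩, P.n, P.repr g)
      = (S.run κ (⟨κ⟩, P.n, P.repr g)).bind fun c =>
        (coinView N d t (m.eval κ) κ P g c.1 (sel c.2.1)).bind fun v =>
          (M.run κ ((⟨κ⟩, P.n, P.repr g), v, c.2.2)).bind fun w =>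
            PMF.pure (Claim.correct P (N κ) (d κ) (t κ) c.2.1 w) := by
    let pub : Pub := (⟨κ⟩, P.n, P.repr g)
    let out : List Bool × Histories × Data → ℕ → ℕ → PMF Bool := fun c x y =>
      PMF.pure (Claim.correct P (N κ) (d κ) (t κ) c.2.1 (M.fn (y, pub,
        simView N d t ⟨κ⟩ P.n (P.repr g) c.1 (sel c.2.1) x, c.2.2)))
    rw [PPT.run, map_eq_bind, PPT.run_bind]
    simp only [recoverDistinguisher, natCorrect_eq]
    refine (uniform_tape_bind (Polynomial.eval_add) fun x ρ => out (S.fn (x, pub))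
      (ρ % 2 ^ m.eval κ) (ρ / 2 ^ m.eval κ)).trans ?_
    congr 1
    funext x
    rw [coinView, PMF.bind_map]
    refine (uniform_tape_bind (Polynomial.eval_add) fun v ρ => out (S.fn (x, pub)) v ρ).trans ?_
    congr 1
    funext v
    rw [Function.comp_apply, PPT.run_bind]
  rw [hrun]
  exact abs_prob_bind_le _ _ _ _ fun c _ => hδ _ _ _

/-- The lossy experiment is the same for every `sel`, so it links true uploads (`id`) to encryptions
of `0` (constant `[]`). Claims are always judged against the true histories. -/
theorem negligible_recover_sub_lossy {gen : PrimeGen} (hDCR : DCR gen) (hN : EfficientParam N)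
    (hd : EfficientParam d) (ht : EfficientParam t) (hsel : PolyTime sel) :
    Negligible fun κ => |prob (honestGame gen (recoverInner N d t S M sel) κ)
      - prob (lossyGame gen (recoverInner N d t S M fun _ => []) κ)| := by
  obtain ⟨m, δ, hδ, hclose⟩ := exists_statClose_coinView gen t hN hd
  have h := negligible_honest_sub_lossy hDCR (recoverInner N d t S M sel)
    (recoverDistinguisher N d t S M sel hsel m hN hd ht) hδ fun κ P hP g =>
      abs_recoverDistinguisher_sub_le N d t S M sel hsel m hN hd ht κ P g _ (hclose κ P hP g)
  have hlossy : lossyGame gen (recoverInner N d t S M sel)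
      = lossyGame gen (recoverInner N d t S M fun _ => []) := by
    funext κ
    simp only [lossyGame, recoverInner_pow_n N d t S M sel]
  simpa only [hlossy] using h

/-- The algorithm that runs `M` on a simulated view, with encryptions of `0` as uploads. -/
def simulator (m : Polynomial ℕ) (hN : EfficientParam N) (hd : EfficientParam d)
    (ht : EfficientParam t) : PPT (Pub × List Bool × Data) Claim where
  coins := m + M.coins
  fn x :=
    let u := x.2.1.1
    M.fn (x.1 / 2 ^ m.eval u.len, x.2.1,
      simView N d t u x.2.1.2.1 x.2.1.2.2 x.2.2.1 [] (x.1 % 2 ^ m.eval u.len), x.2.2.2)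
  polyTime := by
    refine .ppt M (.mk ?_ (.mk ?_ (.mk (.simView hN hd ht ?_ ?_ ?_ ?_ (.const _) ?_) ?_))) <;>
      fun_prop

theorem abs_recoverInner_nil_sub_blindGame_le (gen : PrimeGen) (m : Polynomial ℕ)
    (hN : EfficientParam N) (hd : EfficientParam d) (ht : EfficientParam t) (κ : ℕ) (δ : ℝ)
    (hδ : ∀ P ∈ (gen.law κ).support, ∀ g f h, StatClose δ (coinView N d t (m.eval κ) κ P g f h)
      (viewLaw P g (N κ) (d κ) (t κ) f h)) :
    |prob (honestGame gen (recoverInner N d t S M fun _ => []) κ)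
      - prob (blindGame gen N d t S (simulator N d t M m hN hd ht) κ)| ≤ δ := by
  refine abs_prob_bind_le _ _ _ _ fun P hP => abs_prob_bind_le _ _ _ _ fun g _ =>
    abs_prob_bind_le _ _ _ _ fun c _ => ?_
  have hrun : ((simulator N d t M m hN hd ht).run κ
      ((⟨κ⟩, P.n, P.repr g.1), statusList (N κ) c.1, c.2.2)).bind
        (fun w => PMF.pure (Claim.correct P (N κ) (d κ) (t κ) c.2.1 w))
      = (coinView N d t (m.eval κ) κ P g.1 (statusList (N κ) c.1) []).bind fun v =>
          (M.run κ ((⟨κ⟩, P.n, P.repr g.1), v, c.2.2)).bind fun w =>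
            PMF.pure (Claim.correct P (N κ) (d κ) (t κ) c.2.1 w) := by
    rw [PPT.run_bind, coinView, PMF.bind_map]
    refine (uniform_tape_bind (Polynomial.eval_add) fun x y => PMF.pure (Claim.correct P (N κ) (d κ)
      (t κ) c.2.1 (M.fn (y, (⟨κ⟩, P.n, P.repr g.1), simView N d t ⟨κ⟩ P.n (P.repr g.1)
        (statusList (N κ) c.1) [] x, c.2.2)))).trans ?_
    congr 1
    funext x
    rw [Function.comp_apply, PPT.run_bind]
  have h := (hδ P hP g.1 (statusList (N κ) c.1) []).symm
  rw [viewLaw_statusList] at h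
  have h' := h fun v => (M.run κ ((⟨κ⟩, P.n, P.repr g.1), v, c.2.2)).bind fun w =>
    PMF.pure (Claim.correct P (N κ) (d κ) (t κ) c.2.1 w)
  rw [← hrun] at h'
  exact h'

/-- The simulator depends on `M` and on the number `m` of view coins, not on `S`, so it can be fixed
before the sampler. The error adds three steps: true uploads to the lossy key, back to an honest key
with uploads of `0`, and from ideal randomness to coins. -/
theorem exists_simulator {gen : PrimeGen} (hDCR : DCR gen) (hN : EfficientParam N)
    (hd : EfficientParam d) (ht : EfficientParam t) :
    ∃ M' : PPT (Pub × List Bool × Data) Claim, ∀ S : PPT Pub (List Bool × Histories × Data),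
      ∃ ε : ℕ → ℝ, Negligible ε ∧ ∀ κ, prob (recoverGame gen N d t S M κ)
        ≤ prob (blindGame gen N d t S M' κ) + ε κ := by
  obtain ⟨m, δ, hδ, hclose⟩ := exists_statClose_coinView gen t hN hd
  refine ⟨simulator N d t M m hN hd ht, fun S => ?_⟩
  have h₁ := negligible_recover_sub_lossy N d t S M id hDCR hN hd ht .id
  have h₂ := negligible_recover_sub_lossy N d t S M (fun _ => []) hDCR hN hd ht (.const _)
  refine ⟨_, (h₁.add h₂).add hδ, fun κ => ?_⟩
  have h₃ := abs_recoverInner_nil_sub_blindGame_le N d t S M gen m hN hd ht κ (δ κ)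
    fun P hP g f h => hclose κ P hP g f h
  rw [recoverGame_eq]
  have a₁ := le_abs_self (prob (honestGame gen (recoverInner N d t S M id) κ)
      - prob (lossyGame gen (recoverInner N d t S M fun _ => []) κ))
  have a₂ := neg_abs_le (prob (honestGame gen (recoverInner N d t S M fun _ => []) κ)
      - prob (lossyGame gen (recoverInner N d t S M fun _ => []) κ))
  have a₃ := (abs_le.1 h₃).2
  simp only [Pi.add_apply]
  linarith

end Recovery

end VerFU

end

theorem theorem2 (gen : VerFU.PrimeGen) (hDCR : VerFU.DCR gen) (N d t : ℕ → ℕ)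
    (hN : VerFU.EfficientParam N) (hd : VerFU.EfficientParam d) (ht : VerFU.EfficientParam t) :
    (∀ (A : VerFU.PPT VerFU.Pub (List Bool × VerFU.Histories × VerFU.Histories × VerFU.Data))
        (B : VerFU.PPT (VerFU.Pub × VerFU.View × VerFU.Data) Bool),
        VerFU.Negligible fun κ => |VerFU.prob (VerFU.indGame gen N d t A B κ) - 1 / 2|) ∧
    (∀ M : VerFU.PPT (VerFU.Pub × VerFU.View × VerFU.Data) VerFU.Claim,
      ∃ M' : VerFU.PPT (VerFU.Pub × List Bool × VerFU.Data) VerFU.Claim,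
        ∀ S : VerFU.PPT VerFU.Pub (List Bool × VerFU.Histories × VerFU.Data),
          ∃ ε : ℕ → ℝ, VerFU.Negligible ε ∧ ∀ κ,
            VerFU.prob (VerFU.recoverGame gen N d t S M κ)
              ≤ VerFU.prob (VerFU.blindGame gen N d t S M' κ) + ε κ) :=
  ⟨fun A B => VerFU.negligible_indGame N d t A B hDCR hN hd ht,
    fun M => VerFU.exists_simulator N d t M hDCR hN hd ht⟩
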